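/- Definitions. An extended metric on a set $X$ is a symmetric map $d:X\times X\to[0,\infty]$ together with a set $\Omega\subset X$ with at most one element, such that $d$ restricts to a (finite) metric on $X\setminus\Omega$, $d(x,\omega)=\infty$ for $x\in X\setminus\Omega$ and $\omega\in\Omega$, and $d(\omega,\omega)=0$. The point of $\Omega$, if there is one, is called the remote point $\infty$. $X$ carries the topology generated by the open balls around points of $X\setminus\Omega$ and the complements of the closed balls around points of $X\setminus\Omega$. A quadruple $(x,y,z,w)\in X^4$ is admissible if no entry occurs three or four times in it; its cross ratio triple is the point $$\operatorname{crt}(x,y,z,w)=\bigl(d(x,y)d(z,w):d(x,z)d(y,w):d(x,w)d(y,z)\bigr)\in\mathbb{R}P^2,$$ where common infinite factors are cancelled, i.e. $\operatorname{crt}(x,y,z,\infty)=(d(x,y):d(x,z):d(y,z))$ and $\operatorname{crt}(x,y,\infty,\infty)=(0:1:1)$, and similarly for the other positions of $\infty$. Two extended metric spaces are Möbius equivalent if there is a bijection between them that preserves the cross ratio triples of all admissible quadruples. $(X,d)$ is Ptolemy if $d(x,y)d(z,w)\le d(x,z)d(y,w)+d(x,w)d(y,z)$ for all $x,y,z,w\in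 X$. A circle in $X$ is a subset $\sigma\subset X$ homeomorphic to $S^1$ such that $d(x,z)d(y,w)=d(x,y)d(z,w)+d(x,w)d(y,z)$ for all distinct $x,y,z,w\in\sigma$ for which $y$ and $w$ lie in different components of $\sigma\setminus\{x,z\}$; if one of the points is $\infty$, these relations are read with the infinite factors cancelled as above. The chordal metric $d_0$ on $S^n$ is the restriction of the Euclidean metric of $\mathbb{R}^{n+1}$ to the unit sphere $S^n\subset\mathbb{R}^{n+1}$. Theorem. Let $(X,d)$ be a compact extended Ptolemy metric space that contains at least three points. If any three distinct points of $X$ lie on a circle, then $X$ is Möbius equivalent to $(S^n,d_0)$ for some integer $n\ge 1$. -/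

import Mathlib

open scoped ENNReal NNReal LinearAlgebra.Projectivization

/-- An extended metric on `X`: a symmetric map `d : X × X → [0, ∞]` and a set `Ω` with at most one
element (the infinitely remote point) such that `d` is a (finite) metric on `X \ Ω`,
`d x ω = ∞` for `x ∉ Ω`, `ω ∈ Ω`, and `d ω ω = 0` for `ω ∈ Ω`. -/
structure ExtendedMetric (X : Type*) where
  d : X → X → ℝ≥0∞
  Ω : Set X
  Ω_subsingleton : Ω.Subsingleton
  symm : ∀ x y, d x y = d y x
  ne_top : ∀ x y, x ∉ Ω → y ∉ Ω → d x y ≠ ∞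
  eq_zero_iff : ∀ x y, x ∉ Ω → y ∉ Ω → (d x y = 0 ↔ x = y)
  triangle : ∀ x y z, x ∉ Ω → y ∉ Ω → z ∉ Ω → d x z ≤ d x y + d y z
  remote : ∀ x ω, x ∉ Ω → ω ∈ Ω → d x ω = ∞
  remote_self : ∀ ω ∈ Ω, d ω ω = 0

/-- A quadruple is admissible if no entry occurs three or four times in it. -/
def Admissible {X : Type*} (x y z w : X) : Prop :=
  ¬ (x = y ∧ y = z) ∧ ¬ (x = y ∧ y = w) ∧ ¬ (x = z ∧ z = w) ∧ ¬ (y = z ∧ z = w)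

theorem Admissible.map {X Y : Type*} {x y z w : X} (h : Admissible x y z w) {f : X → Y}
    (hf : Function.Injective f) : Admissible (f x) (f y) (f z) (f w) := by
  simpa only [Admissible, hf.eq_iff] using h

namespace ExtendedMetric

variable {X Y : Type*}

/-- The topology of an extended metric space, generated by the open balls around the points
`x ∉ Ω` and the complements of the closed balls around such points. -/
@[reducible] def topology (D : ExtendedMetric X) : TopologicalSpace X :=
  TopologicalSpace.generateFrom
    ({U | ∃ x, x ∉ D.Ω ∧ ∃ r : ℝ≥0, 0 < r ∧ U = {y | D.d x y < r}} ∪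
      {U | ∃ x, x ∉ D.Ω ∧ ∃ r : ℝ≥0, 0 < r ∧ U = {y | D.d x y ≤ r}ᶜ})

/-- The distance as a real number, where an infinite distance is replaced by `1`: this is how one
cancels common infinite factors in homogeneous coordinates built from distances. -/
noncomputable def rdist (D : ExtendedMetric X) (x y : X) : ℝ :=
  open Classical in if D.d x y = ∞ then 1 else (D.d x y).toReal

/-- Homogeneous coordinates `(d(x,y) d(z,w), d(x,z) d(y,w), d(x,w) d(y,z))` of the cross ratio
triple. If exactly one entry is the remote point, the (common) infinite factors are dropped, for
example `(d(x,y), d(x,z), d(y,z))` if `w = ∞`; if `z = w = ∞` are remote and `x, y` are not, the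
triple is `(0, 1, 1)`; similarly for the other positions. -/
noncomputable def triple (D : ExtendedMetric X) (x y z w : X) : Fin 3 → ℝ :=
  ![D.rdist x y * D.rdist z w, D.rdist x z * D.rdist y w, D.rdist x w * D.rdist y z]

theorem rdist_eq_zero_iff (D : ExtendedMetric X) (x y : X) : D.rdist x y = 0 ↔ x = y := by
  have key : D.d x y = 0 ↔ x = y := by
    by_cases hx : x ∈ D.Ω <;> by_cases hy : y ∈ D.Ω
    · have hxy := D.Ω_subsingleton hx hy
      subst hxy
      simp [D.remote_self x hx]
    · have h1 := D.remote y x hy hx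
      rw [D.symm] at h1
      have h2 : x ≠ y := fun h => hy (h ▸ hx)
      simp [h1, h2]
    · have h1 := D.remote x y hx hy
      have h2 : x ≠ y := fun h => hx (h ▸ hy)
      simp [h1, h2]
    · exact D.eq_zero_iff x y hx hy
  unfold rdist
  split_ifs with h
  · simp [← key, h]
  · rw [ENNReal.toReal_eq_zero_iff, ← key]
    simp [h]

theorem triple_ne_zero (D : ExtendedMetric X) {x y z w : X} (h : Admissible x y z w) :
    D.triple x y z w ≠ 0 := by
  intro h0
  have e0 := congrFun h0 0
  have e1 := congrFun h0 1
  have e2 := congrFun h0 2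
  simp [triple, rdist_eq_zero_iff] at e0 e1 e2
  unfold Admissible at h
  grind

/-- The cross ratio triple of an admissible quadruple, a point of the real projective plane. -/
noncomputable def crt (D : ExtendedMetric X) {x y z w : X} (h : Admissible x y z w) :
    ℙ ℝ (Fin 3 → ℝ) :=
  Projectivization.mk ℝ (D.triple x y z w) (D.triple_ne_zero h)

/-- Möbius maps: injective maps that preserve the cross ratio triples of admissible quadruples. -/
structure IsMoebius (D : ExtendedMetric X) (E : ExtendedMetric Y) (f : X → Y) : Prop where
  injective : Function.Injective f
  crt_map : ∀ (x y z w : X) (h : Admissible x y z w), E.crt (h.map injective) = D.crt h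

/-- Möbius equivalence: there is a bijective Möbius map. -/
def MoebiusEquivalent (D : ExtendedMetric X) (E : ExtendedMetric Y) : Prop :=
  ∃ f : X → Y, Function.Bijective f ∧ IsMoebius D E f

/-- The Ptolemy inequality `d(x,y) d(z,w) ≤ d(x,z) d(y,w) + d(x,w) d(y,z)`, read through the
homogeneous coordinates `triple` if one of the points is the remote point. -/
def IsPtolemy (D : ExtendedMetric X) : Prop :=
  ∀ x y z w : X, D.triple x y z w 0 ≤ D.triple x y z w 1 + D.triple x y z w 2

/-- A circle: a subset `σ` homeomorphic to `S¹` such that the Ptolemy equality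
`d(x,z) d(y,w) = d(x,y) d(z,w) + d(x,w) d(y,z)` holds for all distinct `x, y, z, w ∈ σ` in this
order, that is, with `y` and `w` in different connected components of `σ \ {x, z}`. If one of the
points is the remote point, the equality is read through the homogeneous coordinates `triple`. -/
def IsCircle (D : ExtendedMetric X) (σ : Set X) : Prop :=
  letI : TopologicalSpace X := D.topology
  Nonempty (σ ≃ₜ Circle) ∧
    ∀ x ∈ σ, ∀ y ∈ σ, ∀ z ∈ σ, ∀ w ∈ σ, [x, y, z, w].Nodup →
      w ∉ connectedComponentIn (σ \ {x, z}) y →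
        D.triple x y z w 1 = D.triple x y z w 0 + D.triple x y z w 2

/-- A metric space as an extended metric space without remote point. -/
noncomputable def ofMetricSpace (Y : Type*) [MetricSpace Y] : ExtendedMetric Y where
  d := edist
  Ω := ∅
  Ω_subsingleton := Set.subsingleton_empty
  symm := edist_comm
  ne_top x y _ _ := edist_ne_top x y
  eq_zero_iff _ _ _ _ := edist_eq_zero
  triangle x y z _ _ _ := edist_triangle x y z
  remote _ _ _ h := h.elim
  remote_self _ h := h.elim

/-- The chordal metric on the unit sphere `S^n` of Euclidean space of dimension `n + 1`. -/
noncomputable def chordalSphere (n : ℕ) :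
    ExtendedMetric (Metric.sphere (0 : EuclideanSpace ℝ (Fin (n + 1))) 1) :=
  ofMetricSpace _

end ExtendedMetric

/-! The hypotheses are Möbius invariant, so the extended metric is first replaced by a conformally
equivalent finite one (`IsPtolemy.metricSpace`), in which the remote point plays no special role. By
the Ptolemy inequality, inversion at a point `w` gives a metric `invDist w` on the complement of
`w`. The Ptolemy equality turns circles through `w` into lines, so any two points lie on a line in
every inversion (`IsPtolemy.hasInvLines`). It then suffices that the inversion at one point `y` is
Euclidean: stereographic projection turns it into the chordal sphere (`exists_bijective_sphere`).

Busemann functions of a Ptolemy space are convex at midpoints. Here they are also concave at some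
midpoint, found as a limit of midpoints taken in inversions at points that run to `y` along the line
(`InvSpace.busemannConcave`). If midpoints are unique, Busemann functions are therefore affine, and
they recover the distance. Evaluation on affine functions then embeds the inverted space
isometrically onto a linear subspace of a function space (`exists_isometryEquiv_normedSpace`). A
Ptolemy norm comes from an inner product (`parallelogram_of_ptolemy`), and properness gives finite
dimension.

Unique midpoints follow once geodesics do not branch, which is proved only at a generic `y`
(`PtolemySpace.exists_nonMerging`). By a Baire argument, branching at a generic point would persist
on an open set, with the two branch points near fixed `z₀` and `w`. Differentiating the distances
along a line through that set contradicts this: branch points have equal logarithmic derivatives,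
whereas those of `z₀` and `w` differ by a definite amount
(`PtolemySpace.false_of_persistent_merging`). -/

/-! ### Normed spaces with the Ptolemy inequality are inner product spaces. -/

section PtolemyNormed

variable {E : Type*} [NormedAddCommGroup E] [NormedSpace ℝ E]

/-- The pair `x, y` of unit vectors spans a parallelogram of maximal area among the pairs of unit
vectors of its plane. -/
structure IsMaximalPair (x y : E) : Prop where
  left : ‖x‖ = 1
  right : ‖y‖ = 1
  area : ∀ a b c d : ℝ, |a * d - b * c| ≤ ‖a • x + b • y‖ * ‖c • x + d • y‖

/-- For the diagonal lengths `A`, `B`, Ptolemy and maximality give `A * B = 2`. For the normalized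
diagonals they give `((A + B) / 2) ^ 2 ≤ 2 = A * B`, which forces `A = B`. -/
theorem IsMaximalPair.norm_add_eq {x y : E}
    (hP : ∀ u v : E, ‖u + v‖ * ‖u - v‖ ≤ ‖u‖ ^ 2 + ‖v‖ ^ 2) (h : IsMaximalPair x y) :
    ‖x + y‖ = √2 ∧ ‖x - y‖ = √2 := by
  set A := ‖x + y‖ with hA
  set B := ‖x - y‖ with hB
  have hA0 : 0 ≤ A := norm_nonneg _
  have hB0 : 0 ≤ B := norm_nonneg _
  have h1 : A * B ≤ 2 := by
    have := hP x y
    rw [h.left, h.right] at this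
    linarith
  have h2 : 2 ≤ A * B := by
    have := h.area 1 1 1 (-1)
    norm_num [← sub_eq_add_neg] at this
    linarith
  have hAB : A * B = 2 := le_antisymm h1 h2
  have hApos : 0 < A := by
    rcases hA0.eq_or_lt with h0 | h0
    · rw [← h0] at hAB; norm_num at hAB
    · exact h0
  have hBpos : 0 < B := by
    rcases hB0.eq_or_lt with h0 | h0
    · rw [← h0] at hAB; norm_num at hAB
    · exact h0
  have h3 := hP (A⁻¹ • (x + y)) (B⁻¹ • (x - y))
  rw [norm_smul, norm_smul, norm_inv, norm_inv, Real.norm_of_nonneg hA0, Real.norm_of_nonneg hB0,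
    ← hA, ← hB, inv_mul_cancel₀ hApos.ne', inv_mul_cancel₀ hBpos.ne'] at h3
  have e1 : A⁻¹ • (x + y) + B⁻¹ • (x - y) = (A⁻¹ + B⁻¹) • x + (A⁻¹ - B⁻¹) • y := by module
  have e2 : A⁻¹ • (x + y) - B⁻¹ • (x - y) = (A⁻¹ - B⁻¹) • x + (A⁻¹ + B⁻¹) • y := by module
  have h4 := h.area (A⁻¹ + B⁻¹) (A⁻¹ - B⁻¹) 0 1
  have h5 := h.area (A⁻¹ - B⁻¹) (A⁻¹ + B⁻¹) 1 0
  rw [← e1] at h4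
  rw [← e2] at h5
  simp only [zero_smul, one_smul, zero_add, add_zero, h.left, h.right, mul_one, mul_zero,
    sub_zero, zero_sub, abs_neg] at h4 h5
  have hsum : A⁻¹ + B⁻¹ = (A + B) / 2 := by
    field_simp
    rw [hAB]; ring
  have hpos : 0 ≤ A⁻¹ + B⁻¹ := by positivity
  rw [abs_of_nonneg hpos] at h4 h5
  have h6 : (A⁻¹ + B⁻¹) * (A⁻¹ + B⁻¹) ≤ 2 :=
    (mul_le_mul h4 h5 hpos (norm_nonneg _)).trans (h3.trans (by norm_num))
  rw [hsum] at h6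
  have hEq : A = B := by nlinarith [sq_nonneg (A - B)]
  have hA2 : A = √2 := by
    rw [eq_comm, Real.sqrt_eq_iff_mul_self_eq (by norm_num) hA0]
    rw [← hEq] at hAB
    exact hAB.symm
  exact ⟨hA2, hEq ▸ hA2⟩

/-- Ptolemy bounds `p * q` and `s * r` above by `t`, maximality bounds `p * r` and `q * s` below by
`t`. Both pairs have the same product, so equality holds throughout. -/
theorem IsMaximalPair.norm_mul_eq {x y : E}
    (hP : ∀ u v : E, ‖u + v‖ * ‖u - v‖ ≤ ‖u‖ ^ 2 + ‖v‖ ^ 2) (h : IsMaximalPair x y) (a b : ℝ) :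
    ‖a • x + b • y‖ * ‖a • x - b • y‖ = a ^ 2 + b ^ 2 ∧
      ‖a • x + b • y‖ * ‖(-b) • x + a • y‖ = a ^ 2 + b ^ 2 := by
  obtain ⟨hs1, hs2⟩ := h.norm_add_eq hP
  have hrefl : ∀ a b : ℝ, ‖a • x + b • y‖ * ‖a • x - b • y‖ ≤ a ^ 2 + b ^ 2 := by
    intro a b
    have := hP (a • x) (b • y)
    simpa [norm_smul, h.left, h.right] using this
  have hdiag : ∀ a b : ℝ, ‖a • x + b • y‖ * ‖b • x + a • y‖ ≤ a ^ 2 + b ^ 2 := by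
    intro a b
    have := hP (((a + b) / 2) • (x + y)) (((a - b) / 2) • (x - y))
    rw [norm_smul, norm_smul, hs1, hs2, mul_pow, mul_pow, Real.sq_sqrt (by norm_num),
      Real.norm_eq_abs, Real.norm_eq_abs, sq_abs, sq_abs] at this
    have e1 : ((a + b) / 2) • (x + y) + ((a - b) / 2) • (x - y) = a • x + b • y := by module
    have e2 : ((a + b) / 2) • (x + y) - ((a - b) / 2) • (x - y) = b • x + a • y := by module
    rw [e1, e2] at this
    linarith
  rcases eq_or_ne (a ^ 2 + b ^ 2) 0 with h0 | h0
  · have ha : a = 0 := by nlinarith [sq_nonneg a, sq_nonneg b]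
    have hb : b = 0 := by nlinarith [sq_nonneg a, sq_nonneg b]
    simp [ha, hb]
  have hr : 0 < a ^ 2 + b ^ 2 := lt_of_le_of_ne (by positivity) (Ne.symm h0)
  have u1 := hrefl a b
  have u2 := hdiag (-b) a
  have l1 := h.area a b (-b) a
  have l2 := h.area a (-b) b a
  have e3 : ‖a • x + (-b) • y‖ = ‖a • x - b • y‖ := by rw [neg_smul, ← sub_eq_add_neg]
  rw [e3] at l2
  have hab : |a * a - b * (-b)| = a ^ 2 + b ^ 2 := by
    rw [abs_of_nonneg] <;> nlinarith
  have hab' : |a * a - (-b) * b| = a ^ 2 + b ^ 2 := by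
    rw [abs_of_nonneg] <;> nlinarith
  rw [hab] at l1
  rw [hab'] at l2
  have u3 := hrefl b a
  have e5 : ‖(-b) • x + a • y‖ = ‖b • x - a • y‖ := by rw [← norm_neg]; congr 1; module
  rw [← e5, add_comm (b ^ 2)] at u3
  set p := ‖a • x + b • y‖
  set q := ‖a • x - b • y‖
  set r := ‖(-b) • x + a • y‖
  set s := ‖b • x + a • y‖
  have hp : 0 ≤ p := norm_nonneg _
  have hq : 0 ≤ q := norm_nonneg _
  have hrr : 0 ≤ r := norm_nonneg _
  have hss : 0 ≤ s := norm_nonneg _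
  set t := a ^ 2 + b ^ 2
  have m1 : t * t ≤ (p * r) * (q * s) := mul_le_mul l1 l2 hr.le (by positivity)
  have m2 : (p * r) * (q * s) = (p * q) * (s * r) := by ring
  have k1 : p * q = t := by
    refine le_antisymm u1 ?_
    by_contra hlt
    push Not at hlt
    have : (p * q) * (s * r) < t * t := by
      calc (p * q) * (s * r) ≤ (p * q) * t := by gcongr
        _ < t * t := by gcongr
    linarith
  refine ⟨k1, le_antisymm ?_ l1⟩
  by_contra hlt
  push Not at hlt
  have : t * t < (p * r) * (q * s) := by
    calc t * t < (p * r) * t := by gcongr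
      _ ≤ (p * r) * (q * s) := by gcongr
  have : (p * q) * (s * r) ≤ t * t := by rw [k1]; gcongr
  linarith

/-- Rotating a maximal pair gives another one, and reflecting `x` in the rotated axes doubles the
angle. This expresses the norm at the doubled angle through the norm at the original angle.
Comparing the angles `±` leaves only the Euclidean value. -/
theorem IsMaximalPair.norm_sq_eq {x y : E}
    (hP : ∀ u v : E, ‖u + v‖ * ‖u - v‖ ≤ ‖u‖ ^ 2 + ‖v‖ ^ 2) (h : IsMaximalPair x y) (a b : ℝ) :
    ‖a • x + b • y‖ ^ 2 = a ^ 2 + b ^ 2 := by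
  have double : ∀ a b : ℝ, 0 < a ^ 2 + b ^ 2 → ‖(a ^ 2 - b ^ 2) • x + (2 * a * b) • y‖ =
      a ^ 2 * ‖a • x + b • y‖ ^ 2 / (a ^ 2 + b ^ 2) +
        b ^ 2 * (a ^ 2 + b ^ 2) / ‖a • x + b • y‖ ^ 2 := by
    intro a b hr
    obtain ⟨-, k⟩ := h.norm_mul_eq hP a b
    set l := ‖a • x + b • y‖ with hl
    set r := a ^ 2 + b ^ 2 with hrdef
    have hl0 : 0 < l := by
      rcases (norm_nonneg (a • x + b • y)).eq_or_lt with h0 | h0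
      · rw [← hl] at h0; rw [← h0] at k; simp at k; linarith
      · exact h0
    have hm : ‖(-b) • x + a • y‖ = r / l := by field_simp; linarith
    -- The change of basis has determinant `l⁻¹ * (l / r) * r = 1`, so the area bound is inherited.
    have h' : IsMaximalPair (l⁻¹ • (a • x + b • y)) ((l / r) • ((-b) • x + a • y)) := by
      refine ⟨?_, ?_, ?_⟩
      · rw [norm_smul, norm_inv, Real.norm_of_nonneg hl0.le, ← hl, inv_mul_cancel₀ hl0.ne']
      · rw [norm_smul, Real.norm_of_nonneg (by positivity), hm]; field_simp
      · intro a' b' c' d'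
        have := h.area (a' * l⁻¹ * a - b' * (l / r) * b) (a' * l⁻¹ * b + b' * (l / r) * a)
          (c' * l⁻¹ * a - d' * (l / r) * b) (c' * l⁻¹ * b + d' * (l / r) * a)
        have e : (a' * l⁻¹ * a - b' * (l / r) * b) * (c' * l⁻¹ * b + d' * (l / r) * a) -
            (a' * l⁻¹ * b + b' * (l / r) * a) * (c' * l⁻¹ * a - d' * (l / r) * b) =
            a' * d' - b' * c' := by
          have : (a' * l⁻¹ * a - b' * (l / r) * b) * (c' * l⁻¹ * b + d' * (l / r) * a) -
            (a' * l⁻¹ * b + b' * (l / r) * a) * (c' * l⁻¹ * a - d' * (l / r) * b) =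
            (a' * d' - b' * c') * (l⁻¹ * (l / r) * (a ^ 2 + b ^ 2)) := by ring
          rw [this, ← hrdef]
          field_simp
        rw [e] at this
        convert this using 3 <;> module
    -- These are the coordinates of `x` in the new pair; changing the sign of the second one yields
    -- the doubled angle.
    obtain ⟨k', -⟩ := h'.norm_mul_eq hP (a * l / r) (-(b / l))
    have e1 : (a * l / r) • (l⁻¹ • (a • x + b • y)) + (-(b / l)) • ((l / r) • ((-b) • x + a • y)) =
        x := by
      have : (a * l / r) • (l⁻¹ • (a • x + b • y)) +
          (-(b / l)) • ((l / r) • ((-b) • x + a • y)) =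
          ((a ^ 2 + b ^ 2) * (l * l⁻¹) / r) • x := by
        rw [div_eq_mul_inv b l]
        module
      rw [this, ← hrdef, mul_inv_cancel₀ hl0.ne', mul_one, div_self hr.ne', one_smul]
    have e2 : (a * l / r) • (l⁻¹ • (a • x + b • y)) - (-(b / l)) • ((l / r) • ((-b) • x + a • y)) =
        r⁻¹ • ((a ^ 2 - b ^ 2) • x + (2 * a * b) • y) := by
      have : (a * l / r) • (l⁻¹ • (a • x + b • y)) -
          (-(b / l)) • ((l / r) • ((-b) • x + a • y)) =
          ((l * l⁻¹) * r⁻¹) • ((a ^ 2 - b ^ 2) • x + (2 * a * b) • y) := by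
        rw [div_eq_mul_inv b l]
        module
      rw [this, mul_inv_cancel₀ hl0.ne', one_mul]
    rw [e1, e2, h.left, one_mul, norm_smul, norm_inv, Real.norm_of_nonneg hr.le] at k'
    field_simp at k' ⊢
    linarith
  rcases eq_or_ne a 0 with ha | ha
  · simp [ha, norm_smul, h.right]
  rcases eq_or_ne b 0 with hb | hb
  · simp [hb, norm_smul, h.left]
  have hr : 0 < a ^ 2 + b ^ 2 := by positivity
  have d1 := double a b hr
  have d2 := double a (-b) (by simpa using hr)
  obtain ⟨k1, -⟩ := h.norm_mul_eq hP a b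
  obtain ⟨k2, -⟩ := h.norm_mul_eq hP (a ^ 2 - b ^ 2) (2 * a * b)
  have e1 : (a ^ 2 - (-b) ^ 2) • x + (2 * a * -b) • y =
      (a ^ 2 - b ^ 2) • x - (2 * a * b) • y := by module
  have e2 : a • x + (-b) • y = a • x - b • y := by module
  rw [e1, e2, neg_sq] at d2
  rw [d1, d2] at k2
  set r := a ^ 2 + b ^ 2 with hrdef
  set l := ‖a • x + b • y‖ with hl
  set l' := ‖a • x - b • y‖ with hl'
  have hl0 : 0 < l := by
    rcases (norm_nonneg (a • x + b • y)).eq_or_lt with h0 | h0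
    · rw [← hl] at h0; rw [← h0] at k1; simp at k1; linarith
    · exact h0
  have hl'' : l' = r / l := by field_simp; linarith
  rw [hl''] at k2
  have hL : 0 < l ^ 2 := by positivity
  set L := l ^ 2 with hLdef
  rw [div_pow, ← hLdef] at k2
  have hrs : (a ^ 2 - b ^ 2) ^ 2 + (2 * a * b) ^ 2 = r ^ 2 := by rw [hrdef]; ring
  rw [hrs] at k2
  have k3 : (a ^ 2 * L ^ 2 + b ^ 2 * r ^ 2) * (a ^ 2 * r ^ 2 + b ^ 2 * L ^ 2) =
      r ^ 4 * L ^ 2 := by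
    field_simp at k2
    nlinarith [k2]
  have k4 : a ^ 2 * b ^ 2 * (L ^ 2 - r ^ 2) ^ 2 = 0 := by
    have : r ^ 4 * L ^ 2 = (a ^ 2 + b ^ 2) ^ 2 * r ^ 2 * L ^ 2 := by rw [← hrdef]; ring
    rw [this] at k3
    linear_combination k3
  have k5 : L ^ 2 - r ^ 2 = 0 := by
    have : a ^ 2 * b ^ 2 ≠ 0 := by positivity
    simpa [this, ha, hb] using k4
  nlinarith [k5]

/-- The determinant attains its maximum on pairs from the compact unit disc of the plane; by
homogeneity the maximizers are unit vectors and satisfy the area bound. -/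
theorem LinearIndependent.exists_isMaximalPair {u v : E} (huv : LinearIndependent ℝ ![u, v]) :
    ∃ x y : E, IsMaximalPair x y ∧ (∃ a b : ℝ, u = a • x + b • y) ∧
      ∃ a b : ℝ, v = a • x + b • y := by
  let T : ℝ × ℝ →ₗ[ℝ] E :=
    (LinearMap.toSpanSingleton ℝ E u).coprod (LinearMap.toSpanSingleton ℝ E v)
  have hT : ∀ p : ℝ × ℝ, T p = p.1 • u + p.2 • v := fun p => by simp [T]
  have hker : LinearMap.ker T = ⊥ := by
    rw [LinearMap.ker_eq_bot']
    intro p hp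
    rw [hT] at hp
    obtain ⟨h1, h2⟩ := LinearIndependent.pair_iff.1 huv _ _ hp
    exact Prod.ext h1 h2
  have hcont : Continuous T := T.continuous_of_finiteDimensional
  obtain ⟨k, -, hk⟩ := T.exists_antilipschitzWith hker
  have hpos : ∀ p : ℝ × ℝ, p ≠ 0 → 0 < ‖T p‖ := fun p hp =>
    norm_pos_iff.2 fun h => hp ((LinearMap.ker_eq_bot'.1 hker) p h)
  let B : Set (ℝ × ℝ) := {p | ‖T p‖ ≤ 1}
  have hB : IsCompact B := by
    refine Metric.isCompact_of_isClosed_isBounded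
      (isClosed_le hcont.norm continuous_const) ?_
    have hsub : B ⊆ T ⁻¹' Metric.closedBall 0 1 := fun p (hp : ‖T p‖ ≤ 1) => by simpa using hp
    exact (hk.isBounded_preimage Metric.isBounded_closedBall).subset hsub
  let D : (ℝ × ℝ) × (ℝ × ℝ) → ℝ := fun p => p.1.1 * p.2.2 - p.1.2 * p.2.1
  have hD : Continuous D := by fun_prop
  have h0B : ∀ p : ℝ × ℝ, p ≠ 0 → ‖T p‖⁻¹ • p ∈ B := fun p hp => by
    have := hpos p hp
    simp only [B, Set.mem_ofPred_eq, map_smul, norm_smul, norm_inv, norm_norm]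
    rw [inv_mul_cancel₀ this.ne']
  have hne : (B ×ˢ B).Nonempty := ⟨(0, 0), by simp [B]⟩
  obtain ⟨⟨p, q⟩, ⟨hp, hq⟩, hmax⟩ := (hB.prod hB).exists_isMaxOn hne hD.continuousOn
  set M := D (p, q) with hM
  have hle : ∀ p' q' : ℝ × ℝ, D (p', q') ≤ M * (‖T p'‖ * ‖T q'‖) := by
    intro p' q'
    rcases eq_or_ne p' 0 with rfl | hp'
    · simp [D]
    rcases eq_or_ne q' 0 with rfl | hq'
    · simp [D]
    have h1 := hpos p' hp'
    have h2 := hpos q' hq'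
    have := hmax (a := (‖T p'‖⁻¹ • p', ‖T q'‖⁻¹ • q')) ⟨h0B p' hp', h0B q' hq'⟩
    simp only [D, Prod.smul_fst, Prod.smul_snd, smul_eq_mul, Set.mem_ofPred_eq] at this ⊢
    have e : ‖T p'‖⁻¹ * p'.1 * (‖T q'‖⁻¹ * q'.2) - ‖T p'‖⁻¹ * p'.2 * (‖T q'‖⁻¹ * q'.1) =
        (p'.1 * q'.2 - p'.2 * q'.1) / (‖T p'‖ * ‖T q'‖) := by field_simp
    rw [e, div_le_iff₀ (by positivity)] at this
    exact this
  have hMpos : 0 < M := by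
    have := hle (1, 0) (0, 1)
    simp only [D, mul_one, mul_zero, sub_zero] at this
    by_contra hcon
    push Not at hcon
    have : M * (‖T (1, 0)‖ * ‖T (0, 1)‖) ≤ 0 := mul_nonpos_of_nonpos_of_nonneg hcon (by positivity)
    linarith
  have h1 : 1 ≤ ‖T p‖ * ‖T q‖ := by
    have := hle p q
    rw [← hM] at this
    by_contra hcon
    push Not at hcon
    nlinarith
  have hp' : ‖T p‖ ≤ 1 := hp
  have hq' : ‖T q‖ ≤ 1 := hq
  have hp1 : ‖T p‖ = 1 := le_antisymm hp' (by nlinarith [norm_nonneg (T p), norm_nonneg (T q)])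
  have hq1 : ‖T q‖ = 1 := le_antisymm hq' (by nlinarith [norm_nonneg (T p), norm_nonneg (T q)])
  refine ⟨T p, T q, ⟨hp1, hq1, ?_⟩, ?_, ?_⟩
  · intro a b c d
    have key : ∀ a b c d : ℝ, a * d - b * c ≤ ‖a • T p + b • T q‖ * ‖c • T p + d • T q‖ := by
      intro a b c d
      have := hle (a • p + b • q) (c • p + d • q)
      have e : D (a • p + b • q, c • p + d • q) = M * (a * d - b * c) := by
        simp only [hM, D, Prod.fst_add, Prod.snd_add, Prod.smul_fst, Prod.smul_snd, smul_eq_mul]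
        ring
      rw [e] at this
      simpa using le_of_mul_le_mul_left this hMpos
    rw [abs_le]
    refine ⟨?_, key a b c d⟩
    have := key c d a b
    rw [mul_comm ‖c • T p + d • T q‖] at this
    linarith
  -- Cramer's rule, with determinant `M`.
  · refine ⟨q.2 / M, -p.2 / M, ?_⟩
    have e : (q.2 / M) • T p + (-p.2 / M) • T q = ((p.1 * q.2 - p.2 * q.1) / M) • u := by
      rw [hT, hT]; module
    rw [e]
    change u = (M / M) • u
    rw [div_self hMpos.ne', one_smul]
  · refine ⟨-q.1 / M, p.1 / M, ?_⟩
    have e : (-q.1 / M) • T p + (p.1 / M) • T q = ((p.1 * q.2 - p.2 * q.1) / M) • v := by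
      rw [hT, hT]; module
    rw [e]
    change v = (M / M) • v
    rw [div_self hMpos.ne', one_smul]

/-- A real normed space that satisfies the Ptolemy inequality satisfies the parallelogram law. -/
theorem parallelogram_of_ptolemy
    (hP : ∀ u v : E, ‖u + v‖ * ‖u - v‖ ≤ ‖u‖ ^ 2 + ‖v‖ ^ 2) (u v : E) :
    ‖u + v‖ * ‖u + v‖ + ‖u - v‖ * ‖u - v‖ = 2 * (‖u‖ * ‖u‖ + ‖v‖ * ‖v‖) := by
  by_cases huv : LinearIndependent ℝ ![u, v]
  · obtain ⟨x, y, h, ⟨a, b, rfl⟩, ⟨c, d, rfl⟩⟩ := huv.exists_isMaximalPair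
    have e1 : a • x + b • y + (c • x + d • y) = (a + c) • x + (b + d) • y := by module
    have e2 : a • x + b • y - (c • x + d • y) = (a - c) • x + (b - d) • y := by module
    rw [e1, e2]
    simp only [← sq, h.norm_sq_eq hP]
    ring
  · rw [LinearIndependent.pair_iff] at huv
    push Not at huv
    obtain ⟨s, t, hst, hne⟩ := huv
    have key : ∀ (r : ℝ) (w : E), ‖w + r • w‖ * ‖w + r • w‖ + ‖w - r • w‖ * ‖w - r • w‖ =
        2 * (‖w‖ * ‖w‖ + ‖r • w‖ * ‖r • w‖) := by
      intro r w
      have e1 : w + r • w = (1 + r) • w := by module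
      have e2 : w - r • w = (1 - r) • w := by module
      rw [e1, e2]
      simp only [norm_smul, Real.norm_eq_abs]
      have := sq_abs (1 + r)
      have := sq_abs (1 - r)
      have := sq_abs r
      linear_combination ‖w‖ ^ 2 * (sq_abs (1 + r) + sq_abs (1 - r) - 2 * sq_abs r)
    by_cases hs : s = 0
    · have ht := hne hs
      have hv : v = 0 := by simpa [hs, ht] using hst
      simpa [hv] using key 0 u
    · have hu : u = (-(t / s)) • v := by
        have : s⁻¹ • (s • u + t • v) = 0 := by rw [hst, smul_zero]
        rw [smul_add, smul_smul, inv_mul_cancel₀ hs, one_smul, smul_smul] at this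
        rw [eq_neg_of_add_eq_zero_left this, div_eq_inv_mul]
        module
      have := key (-(t / s)) v
      rw [← hu] at this
      rw [add_comm u v, norm_sub_rev u v]
      linarith

end PtolemyNormed

/-! ### Inversions, derivatives of distances, and generic absence of branching. -/

section Inversion

open Filter Topology MeasureTheory

variable {X : Type*} [MetricSpace X]

/-- The Ptolemy inequality in a metric space. -/
def PtolemySpace (X : Type*) [MetricSpace X] : Prop :=
  ∀ x y z w : X, dist x y * dist z w ≤ dist x z * dist y w + dist x w * dist y z

/-- The distance function obtained from `dist` by inversion at `w`, which moves `w` to infinity. -/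
noncomputable def invDist (w a b : X) : ℝ := dist a b / (dist a w * dist b w)

/-- `q` lies between `p` and `r` with respect to the inversion at `y`. -/
def InvBetween (y p q r : X) : Prop :=
  dist q y * dist p r = dist p y * dist q r + dist r y * dist p q

/-- With respect to the inversion at each point `w`, any two points lie on a line. -/
def HasInvLines (X : Type*) [MetricSpace X] : Prop :=
  ∀ w x z : X, x ≠ w → z ≠ w → x ≠ z → ∃ c : ℝ → X, (∀ t, c t ≠ w) ∧
    (∀ s t, invDist w (c s) (c t) = |s - t|) ∧ c 0 = x ∧ c (invDist w x z) = z

theorem invDist_comm (w a b : X) : invDist w a b = invDist w b a := by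
  rw [invDist, invDist, dist_comm a b, mul_comm (dist a w)]

theorem dist_eq_invDist_mul {w a b : X} (ha : a ≠ w) (hb : b ≠ w) :
    dist a b = invDist w a b * (dist a w * dist b w) := by
  have := dist_pos.2 ha
  have := dist_pos.2 hb
  rw [invDist]
  field_simp

theorem invDist_pos {w a b : X} (ha : a ≠ w) (hb : b ≠ w) (hab : a ≠ b) : 0 < invDist w a b :=
  div_pos (dist_pos.2 hab) (mul_pos (dist_pos.2 ha) (dist_pos.2 hb))

theorem InvBetween.invDist_eq {y p q r : X} (hp : p ≠ y) (hq : q ≠ y) (hr : r ≠ y)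
    (h : InvBetween y p q r) : invDist y p r = invDist y p q + invDist y q r := by
  have := dist_pos.2 hp
  have := dist_pos.2 hq
  have := dist_pos.2 hr
  rw [InvBetween] at h
  simp only [invDist]
  field_simp
  linarith

theorem invBetween_of_invDist_eq {y p q r : X} (hp : p ≠ y) (hq : q ≠ y) (hr : r ≠ y)
    (h : invDist y p r = invDist y p q + invDist y q r) : InvBetween y p q r := by
  have := dist_pos.2 hp
  have := dist_pos.2 hq
  have := dist_pos.2 hr
  simp only [invDist] at h
  field_simp at h
  rw [InvBetween]
  linarith

/-- The source of all derivative estimates: as `v` tends to `y`, the right side is small of first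
order with a factor `dist p q`, which the triangle inequality alone does not give. -/
theorem PtolemySpace.abs_sub_le (hP : PtolemySpace X) (p q y v : X) :
    |dist q y * dist p v - dist p y * dist q v| ≤ dist p q * dist v y := by
  rw [abs_le]
  have h1 := hP q v p y
  have h2 := hP p v q y
  rw [dist_comm v p] at h1
  rw [dist_comm v q] at h2
  rw [dist_comm q p] at h1
  constructor <;> linarith

theorem lipschitzWith_of_invDist [CompactSpace X] {w : X} {c : ℝ → X} (hw : ∀ t, c t ≠ w)
    (hc : ∀ s t, invDist w (c s) (c t) = |s - t|) : ∃ K : ℝ≥0, LipschitzWith K c := by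
  obtain ⟨R, hR⟩ := Metric.isBounded_iff.1 (isCompact_univ : IsCompact (Set.univ : Set X)).isBounded
  refine ⟨⟨R * R, mul_self_nonneg R⟩, LipschitzWith.of_dist_le_mul fun s t => ?_⟩
  rw [dist_eq_invDist_mul (hw s) (hw t), hc, Real.dist_eq, mul_comm]
  have h1 := hR (Set.mem_univ (c s)) (Set.mem_univ w)
  have h2 := hR (Set.mem_univ (c t)) (Set.mem_univ w)
  have h0 : 0 ≤ R := dist_nonneg.trans h1
  change _ ≤ R * R * _
  gcongr

/-- Differentiability at a fixed `s` passes to limits of base points, since by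
`PtolemySpace.abs_sub_le` suitably scaled increments for nearby base points are uniformly close.
Hence one null set of parameters serves all base points. -/
theorem PtolemySpace.differentiableAt_of_denseRange (hP : PtolemySpace X) {K : ℝ≥0} {c : ℝ → X}
    (hc : LipschitzWith K c) {u : ℕ → X} (hu : DenseRange u) {s : ℝ}
    (hs : ∀ n, DifferentiableAt ℝ (fun t => dist (u n) (c t)) s) {p : X} (hp : p ≠ c s) :
    DifferentiableAt ℝ (fun t => dist p (c t)) s := by
  have hLip : ∀ q, LipschitzWith K (fun t => dist q (c t)) := fun q => by
    simpa [Function.comp_def] using (LipschitzWith.dist_right q).comp hc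
  obtain ⟨v, hv, hlim⟩ : ∃ v : ℕ → X, (∀ n, ∃ m, v n = u m) ∧ Tendsto v atTop (𝓝 p) := by
    have := hu p
    obtain ⟨v, hv, hlim⟩ := mem_closure_iff_seq_limit.1 this
    exact ⟨v, fun n => by obtain ⟨m, hm⟩ := hv n; exact ⟨m, hm.symm⟩, hlim⟩
  have hd : ∀ n, DifferentiableAt ℝ (fun t => dist (v n) (c t)) s := fun n => by
    obtain ⟨m, hm⟩ := hv n
    rw [hm]; exact hs m
  have hbd : ∀ n, deriv (fun t => dist (v n) (c t)) s ∈ Metric.closedBall (0 : ℝ) K := fun n => by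
    rw [mem_closedBall_zero_iff]
    exact norm_deriv_le_of_lipschitz (hLip (v n))
  obtain ⟨e, -, φ, hφ, he⟩ := (isCompact_closedBall (0 : ℝ) K).tendsto_subseq hbd
  have hlim' := hlim.comp hφ.tendsto_atTop
  refine HasDerivAt.differentiableAt (f' := e) ?_
  rw [hasDerivAt_iff_isLittleO, Asymptotics.isLittleO_iff]
  intro ε hε
  set P := dist p (c s) with hPdef
  have hP0 : 0 < P := dist_pos.2 hp
  have l1 : Tendsto (fun n => dist p (v (φ n)) * K) atTop (𝓝 (dist p p * K)) :=
    ((tendsto_const_nhds.dist hlim').mul_const _)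
  have l2 : Tendsto (fun n => dist (v (φ n)) (c s)) atTop (𝓝 P) :=
    hlim'.dist tendsto_const_nhds
  have l3 : Tendsto (fun n => |P * deriv (fun t => dist (v (φ n)) (c t)) s -
      dist (v (φ n)) (c s) * e|) atTop (𝓝 |P * e - P * e|) :=
    ((he.const_mul P).sub (l2.mul_const e)).abs
  rw [dist_self, zero_mul] at l1
  rw [sub_self, abs_zero] at l3
  have hη : 0 < ε * P / 8 := by positivity
  obtain ⟨n, h1, h2, h3⟩ := ((l1.eventually (gt_mem_nhds hη)).and
    ((l2.eventually (lt_mem_nhds (half_lt_self hP0))).and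
      (l3.eventually (gt_mem_nhds hη)))).exists
  set q := v (φ n)
  set Q := dist q (c s)
  set a := deriv (fun t => dist q (c t)) s
  have hq : HasDerivAt (fun t => dist q (c t)) a s := (hd (φ n)).hasDerivAt
  rw [hasDerivAt_iff_isLittleO, Asymptotics.isLittleO_iff] at hq
  filter_upwards [hq (show 0 < ε / 8 by positivity)] with t ht
  have k1 := hP.abs_sub_le p q (c s) (c t)
  have k2 : dist (c t) (c s) ≤ K * ‖t - s‖ := by
    simpa [Real.dist_eq] using hc.dist_le_mul t s
  simp only [smul_eq_mul, Real.norm_eq_abs] at ht k2 ⊢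
  -- The three terms are controlled by Ptolemy, by differentiability for `q`, and by the convergence
  -- of the derivatives to `e`.
  have e1 : Q * (dist p (c t) - P - (t - s) * e) = (Q * dist p (c t) - P * dist q (c t)) +
      P * (dist q (c t) - Q - (t - s) * a) + (t - s) * (P * a - Q * e) := by ring
  have e2 : Q * |dist p (c t) - P - (t - s) * e| ≤ dist p q * K * |t - s| +
      P * (ε / 8 * |t - s|) + |t - s| * |P * a - Q * e| := by
    have e2 : Q * |dist p (c t) - P - (t - s) * e| = |Q * (dist p (c t) - P - (t - s) * e)| := by
      rw [abs_mul, abs_of_pos ((half_pos hP0).trans h2)]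
    rw [e2, e1]
    refine (abs_add_three _ _ _).trans ?_
    rw [abs_mul P, abs_mul (t - s), abs_of_pos hP0]
    have : dist p q * dist (c t) (c s) ≤ dist p q * K * |t - s| := by
      rw [mul_assoc]; gcongr
    exact add_le_add (add_le_add (k1.trans this) (by gcongr)) le_rfl
  have hQ : P / 2 < Q := h2
  have e3 : Q * |dist p (c t) - P - (t - s) * e| ≤ P / 2 * (ε * |t - s|) := by
    have := abs_nonneg (t - s)
    have b1 : dist p q * K * |t - s| ≤ ε * P / 8 * |t - s| := by gcongr
    have b2 : |t - s| * |P * a - Q * e| ≤ |t - s| * (ε * P / 8) := by gcongr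
    have b3 : 0 ≤ P * (ε * |t - s|) := by positivity
    linarith
  have e4 : P / 2 * |dist p (c t) - P - (t - s) * e| ≤ P / 2 * (ε * |t - s|) :=
    le_trans (by gcongr) e3
  exact le_of_mul_le_mul_left e4 (half_pos hP0)

theorem PtolemySpace.ae_differentiableAt [CompactSpace X] (hP : PtolemySpace X) {K : ℝ≥0}
    {c : ℝ → X} (hc : LipschitzWith K c) :
    ∀ᵐ s : ℝ, ∀ p, p ≠ c s → DifferentiableAt ℝ (fun t => dist p (c t)) s := by
  have : Nonempty X := ⟨c 0⟩
  have hLip : ∀ q, LipschitzWith K (fun t => dist q (c t)) := fun q => by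
    simpa [Function.comp_def] using (LipschitzWith.dist_right q).comp hc
  have hae : ∀ᵐ s : ℝ, ∀ n, DifferentiableAt ℝ
      (fun t => dist (TopologicalSpace.denseSeq X n) (c t)) s :=
    ae_all_iff.2 fun n => (hLip _).ae_differentiableAt_real
  filter_upwards [hae] with s hs p hp
  exact hP.differentiableAt_of_denseRange hc (TopologicalSpace.denseRange_denseSeq X) hs hp

/-- The Ptolemy defect is nonnegative along `c` and vanishes at `s`, so its derivative there is
zero. Thus logarithmic derivatives of distances are affine along geodesics of the inversion at `c
s`. -/
theorem PtolemySpace.deriv_affine (hP : PtolemySpace X) {c : ℝ → X} {s : ℝ}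
    (hs : ∀ p, p ≠ c s → DifferentiableAt ℝ (fun t => dist p (c t)) s) {p q r : X}
    (hp : p ≠ c s) (hq : q ≠ c s) (hr : r ≠ c s) (h : InvBetween (c s) p q r) :
    deriv (fun t => dist q (c t)) s * dist p r = deriv (fun t => dist p (c t)) s * dist q r +
      deriv (fun t => dist r (c t)) s * dist p q := by
  have hd := (((hs p hp).hasDerivAt.mul_const (dist q r)).add
    ((hs r hr).hasDerivAt.mul_const (dist p q))).sub ((hs q hq).hasDerivAt.mul_const (dist p r))
  have hmin : IsLocalMin ((fun t => dist p (c t) * dist q r) + (fun t => dist r (c t) * dist p q) -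
      (fun t => dist q (c t) * dist p r)) s := by
    refine Filter.Eventually.of_forall fun t => ?_
    simp only [Pi.add_apply, Pi.sub_apply]
    rw [InvBetween] at h
    have := hP p r q (c t)
    rw [dist_comm r (c t), dist_comm r q, dist_comm (c t) r] at this
    linarith
  have := hmin.hasDerivAt_eq_zero hd
  linarith

theorem PtolemySpace.deriv_lipschitz (hP : PtolemySpace X) {K : ℝ≥0} {c : ℝ → X}
    (hc : LipschitzWith K c) {s : ℝ}
    (hs : ∀ p, p ≠ c s → DifferentiableAt ℝ (fun t => dist p (c t)) s) {p q : X}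
    (hp : p ≠ c s) (hq : q ≠ c s) :
    |dist q (c s) * deriv (fun t => dist p (c t)) s -
      dist p (c s) * deriv (fun t => dist q (c t)) s| ≤ K * dist p q := by
  have hd := ((hs p hp).hasDerivAt.const_mul (dist q (c s))).sub
    ((hs q hq).hasDerivAt.const_mul (dist p (c s)))
  refine hd.le_of_lip' (by positivity) (Filter.Eventually.of_forall fun t => ?_)
  have k1 := hP.abs_sub_le p q (c s) (c t)
  have k2 := hc.dist_le_mul t s
  simp only [Pi.sub_apply, Real.norm_eq_abs]
  rw [mul_comm (dist q (c s)) (dist p (c s)), sub_self, sub_zero, ← Real.dist_eq t s]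
  refine k1.trans ?_
  rw [mul_comm (K : ℝ), mul_assoc]
  gcongr

/-- In the inversion at `y`, geodesics that have a common piece do not branch. -/
def NonMerging (y : X) : Prop :=
  ∀ z z' q r : X, z ≠ y → z' ≠ y → q ≠ y → r ≠ y → q ≠ r → InvBetween y z q r →
    InvBetween y z' q r → invDist y z q = invDist y z' q → z = z'

/-- Two points `z, z'` whose geodesics branch in the inversion at `y`, with the piece from `q` to
`r` in common and with a lower bound for the distances from `y` and from `q` to `r`. -/
structure MergingTuple (δ : ℝ) (y z z' q r : X) : Prop where
  hqr : δ ≤ dist q r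
  hz : δ ≤ dist z y
  hz' : δ ≤ dist z' y
  hq : δ ≤ dist q y
  hr : δ ≤ dist r y
  left : InvBetween y z q r
  right : InvBetween y z' q r
  eq : dist z q * dist z' y = dist z' q * dist z y

/-- Closedness is what the Baire argument needs; the lower bounds by `δ` prevent degeneration in the
limit, and projection along a compact factor is closed. -/
theorem isClosed_mergingTuple [CompactSpace X] (δ ε : ℝ) (a b : X) :
    IsClosed {y : X | ∃ z z' q r, dist z a ≤ ε ∧ dist z' b ≤ ε ∧ MergingTuple δ y z z' q r} := by
  let S : Set (X × (X × X × X × X)) := {p | dist p.2.1 a ≤ ε ∧ dist p.2.2.1 b ≤ ε ∧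
    MergingTuple δ p.1 p.2.1 p.2.2.1 p.2.2.2.1 p.2.2.2.2}
  have hS : IsClosed S := by
    have : S = {p | dist p.2.1 a ≤ ε} ∩ {p | dist p.2.2.1 b ≤ ε} ∩
      {p | δ ≤ dist p.2.2.2.1 p.2.2.2.2} ∩
      {p | δ ≤ dist p.2.1 p.1} ∩ {p | δ ≤ dist p.2.2.1 p.1} ∩
      {p | δ ≤ dist p.2.2.2.1 p.1} ∩ {p | δ ≤ dist p.2.2.2.2 p.1} ∩
      {p | dist p.2.2.2.1 p.1 * dist p.2.1 p.2.2.2.2 = dist p.2.1 p.1 * dist p.2.2.2.1 p.2.2.2.2 +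
        dist p.2.2.2.2 p.1 * dist p.2.1 p.2.2.2.1} ∩
      {p | dist p.2.2.2.1 p.1 * dist p.2.2.1 p.2.2.2.2 =
        dist p.2.2.1 p.1 * dist p.2.2.2.1 p.2.2.2.2 +
        dist p.2.2.2.2 p.1 * dist p.2.2.1 p.2.2.2.1} ∩
      {p | dist p.2.1 p.2.2.2.1 * dist p.2.2.1 p.1 = dist p.2.2.1 p.2.2.2.1 * dist p.2.1 p.1} := by
      ext p
      constructor
      · rintro ⟨h1, h2, h3, h4, h5, h6, h7, h8, h9, h10⟩
        exact ⟨⟨⟨⟨⟨⟨⟨⟨⟨h1, h2⟩, h3⟩, h4⟩, h5⟩, h6⟩, h7⟩, h8⟩, h9⟩, h10⟩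
      · rintro ⟨⟨⟨⟨⟨⟨⟨⟨⟨h1, h2⟩, h3⟩, h4⟩, h5⟩, h6⟩, h7⟩, h8⟩, h9⟩, h10⟩
        exact ⟨h1, h2, h3, h4, h5, h6, h7, h8, h9, h10⟩
    rw [this]
    refine_lift IsClosed.inter (IsClosed.inter (IsClosed.inter (IsClosed.inter (IsClosed.inter
      (IsClosed.inter (IsClosed.inter (IsClosed.inter (IsClosed.inter ?_ ?_)
      ?_) ?_) ?_) ?_) ?_) ?_) ?_) ?_
    all_goals first
      | exact isClosed_le (by fun_prop) (by fun_prop)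
      | exact isClosed_eq (by fun_prop) (by fun_prop)
  convert isClosedMap_fst_of_compactSpace S hS using 1
  ext y
  constructor
  · rintro ⟨z, z', q, r, h⟩
    exact ⟨(y, z, z', q, r), h, rfl⟩
  · rintro ⟨⟨y', z, z', q, r⟩, h, rfl⟩
    exact ⟨z, z', q, r, h⟩

/-- The logarithmic derivatives of the distances from two merging points agree. -/
theorem PtolemySpace.deriv_eq_of_merging (hP : PtolemySpace X) {c : ℝ → X} {s : ℝ}
    (hs : ∀ p, p ≠ c s → DifferentiableAt ℝ (fun t => dist p (c t)) s) {z z' q r : X}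
    (hz : z ≠ c s) (hz' : z' ≠ c s) (hq : q ≠ c s) (hr : r ≠ c s) (hqr : q ≠ r)
    (h : InvBetween (c s) z q r) (h' : InvBetween (c s) z' q r)
    (heq : invDist (c s) z q = invDist (c s) z' q) :
    deriv (fun t => dist z (c t)) s / dist z (c s) =
      deriv (fun t => dist z' (c t)) s / dist z' (c s) := by
  have key : ∀ z, z ≠ c s → InvBetween (c s) z q r →
      deriv (fun t => dist q (c t)) s / dist q (c s) *
        (invDist (c s) z q + invDist (c s) q r) =
      deriv (fun t => dist z (c t)) s / dist z (c s) * invDist (c s) q r +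
        deriv (fun t => dist r (c t)) s / dist r (c s) * invDist (c s) z q := by
    intro z hz h
    have h1 := hP.deriv_affine hs hz hq hr h
    rw [← h.invDist_eq hz hq hr]
    have := dist_pos.2 hz
    have := dist_pos.2 hq
    have := dist_pos.2 hr
    simp only [invDist]
    field_simp
    linear_combination h1
  have k1 := key z hz h
  have k2 := key z' hz' h'
  rw [heq] at k1
  have h0 := invDist_pos hq hr hqr
  have := k1.symm.trans k2
  have := add_right_cancel this
  exact mul_right_cancel₀ h0.ne' this

/-- Along a line, parametrized in the inversion at `w`, the logarithmic derivatives of the distances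
from `w` and from another point of the line differ. -/
theorem deriv_div_sub_of_line {w : X} {c : ℝ → X} (hw : ∀ t, c t ≠ w)
    (hc : ∀ s t, invDist w (c s) (c t) = |s - t|) {s s₁ : ℝ} (hlt : s < s₁)
    (hs : DifferentiableAt ℝ (fun t => dist w (c t)) s) :
    deriv (fun t => dist (c s₁) (c t)) s / dist (c s₁) (c s) =
      deriv (fun t => dist w (c t)) s / dist w (c s) - 1 / (s₁ - s) := by
  have hd : HasDerivAt (fun t => (s₁ - t) * dist (c s₁) w * dist w (c t))
      ((-1) * dist (c s₁) w * dist w (c s) +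
        (s₁ - s) * dist (c s₁) w * deriv (fun t => dist w (c t)) s) s :=
    (((hasDerivAt_id s).const_sub s₁).mul_const _).mul hs.hasDerivAt
  have hval : ∀ t, t < s₁ → dist (c s₁) (c t) = (s₁ - t) * dist (c s₁) w * dist w (c t) := by
    intro t ht
    rw [dist_eq_invDist_mul (hw s₁) (hw t), hc, abs_of_pos (sub_pos.2 ht), dist_comm (c t) w]
    ring
  have heq : (fun t => dist (c s₁) (c t)) =ᶠ[𝓝 s]
      fun t => (s₁ - t) * dist (c s₁) w * dist w (c t) := by
    filter_upwards [gt_mem_nhds hlt] with t ht using hval t ht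
  rw [(hd.congr_of_eventuallyEq heq).deriv, hval s hlt]
  have := dist_pos.2 (hw s₁)
  have := dist_pos.2 (hw s).symm
  have := sub_pos.2 hlt
  field_simp
  ring

/-- At almost every point of a line in the inversion at `w`, the logarithmic derivatives for `z` and
`z'` agree, and they are close to those for `z₀` and `w`. The latter differ by `1 / (s₁ - s)`, which
is bounded below. -/
theorem PtolemySpace.false_of_persistent_merging [CompactSpace X] (hP : PtolemySpace X)
    (hL : HasInvLines X) {y₀ z₀ w : X} {δ : ℝ} (hδ : 0 < δ) (hzw : z₀ ≠ w) (hzy : z₀ ≠ y₀)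
    (hwy : w ≠ y₀)
    (hev : ∀ ε > 0, ∀ᶠ y in 𝓝 y₀, ∃ z z' q r, dist z z₀ ≤ ε ∧ dist z' w ≤ ε ∧
      MergingTuple δ y z z' q r) : False := by
  obtain ⟨c, hw, hc, hc0, hc1⟩ := hL w y₀ z₀ hwy.symm hzw hzy.symm
  set s₁ := invDist w y₀ z₀ with hs₁
  have hs₁0 : 0 < s₁ := invDist_pos hwy.symm hzw hzy.symm
  obtain ⟨K, hK⟩ := lipschitzWith_of_invDist hw hc
  set m := min (dist z₀ y₀) (dist w y₀) / 2 with hm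
  have hm0 : 0 < m := half_pos (lt_min (dist_pos.2 hzy) (dist_pos.2 hwy))
  have hcont : ContinuousAt c 0 := hK.continuous.continuousAt
  -- Makes each of the two approximation errors less than `1 / (4 * s₁)`, half of the lower bound `1
  -- / (2 * s₁)` for the gap; `K + 1` also covers `K = 0`.
  set ε := δ * m / (4 * s₁ * (K + 1)) with hε
  have hK0 : (0 : ℝ) ≤ K := K.2
  have hε0 : 0 < ε := by positivity
  have h1 : ∀ᶠ s in 𝓝 (0 : ℝ), ∃ z z' q r, dist z z₀ ≤ ε ∧ dist z' w ≤ ε ∧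
      MergingTuple δ (c s) z z' q r := hcont.eventually (by rw [hc0]; exact hev ε hε0)
  have h2 : ∀ᶠ s in 𝓝 (0 : ℝ), m < dist z₀ (c s) := by
    refine (tendsto_const_nhds.dist hcont).eventually (lt_mem_nhds ?_)
    rw [hc0]
    have := min_le_left (dist z₀ y₀) (dist w y₀)
    linarith
  have h3 : ∀ᶠ s in 𝓝 (0 : ℝ), m < dist w (c s) := by
    refine (tendsto_const_nhds.dist hcont).eventually (lt_mem_nhds ?_)
    rw [hc0]
    have := min_le_right (dist z₀ y₀) (dist w y₀)
    linarith
  have h4 : ∀ᶠ s in 𝓝 (0 : ℝ), s < s₁ := gt_mem_nhds hs₁0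
  have h5 : ∀ᶠ s in 𝓝 (0 : ℝ), -s₁ < s := lt_mem_nhds (by linarith)
  have hdense := Measure.dense_of_ae (hP.ae_differentiableAt hK)
  have hnear : {s | (∃ z z' q r, dist z z₀ ≤ ε ∧ dist z' w ≤ ε ∧
      MergingTuple δ (c s) z z' q r) ∧ m < dist z₀ (c s) ∧ m < dist w (c s) ∧ s < s₁ ∧ -s₁ < s} ∈
      𝓝 (0 : ℝ) := h1.and (h2.and (h3.and (h4.and h5)))
  obtain ⟨s, ⟨⟨z, z', q, r, hz, hz', hT⟩, hmz, hmw, hlt, hgt⟩, hs⟩ :=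
    (mem_closure_iff_nhds.1 (hdense 0)) _ hnear
  replace hs : ∀ p, p ≠ c s → DifferentiableAt ℝ (fun t => dist p (c t)) s := hs
  have nz : z ≠ c s := dist_pos.1 (hδ.trans_le hT.hz)
  have nz' : z' ≠ c s := dist_pos.1 (hδ.trans_le hT.hz')
  have nq : q ≠ c s := dist_pos.1 (hδ.trans_le hT.hq)
  have nr : r ≠ c s := dist_pos.1 (hδ.trans_le hT.hr)
  have nqr : q ≠ r := dist_pos.1 (hδ.trans_le hT.hqr)
  have nz0 : z₀ ≠ c s := dist_pos.1 (hm0.trans hmz)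
  have nw : w ≠ c s := dist_pos.1 (hm0.trans hmw)
  have hg : invDist (c s) z q = invDist (c s) z' q := by
    have := dist_pos.2 nz
    have := dist_pos.2 nz'
    have := dist_pos.2 nq
    have h := hT.eq
    simp only [invDist]
    field_simp
    linarith
  have e1 := hP.deriv_eq_of_merging hs nz nz' nq nr nqr hT.left hT.right hg
  have e2 := deriv_div_sub_of_line hw hc hlt (hs w nw)
  rw [hc1] at e2
  have lip : ∀ p p', δ ≤ dist p (c s) → m < dist p' (c s) → dist p p' ≤ ε →
      |deriv (fun t => dist p (c t)) s / dist p (c s) -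
        deriv (fun t => dist p' (c t)) s / dist p' (c s)| ≤ K * ε / (δ * m) := by
    intro p p' hp hp' hpp
    have h0 : 0 < dist p (c s) := hδ.trans_le hp
    have h0' : 0 < dist p' (c s) := hm0.trans hp'
    have := hP.deriv_lipschitz hK hs (dist_pos.1 h0) (dist_pos.1 h0')
    rw [div_sub_div _ _ h0.ne' h0'.ne', abs_div, abs_of_pos (mul_pos h0 h0')]
    rw [mul_comm (dist p' (c s))] at this
    refine (div_le_div_of_nonneg_right this (by positivity)).trans ?_
    gcongr
  have l1 := lip z z₀ hT.hz hmz hz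
  have l2 := lip z' w hT.hz' hmw hz'
  rw [e1, e2] at l1
  have hb : K * ε / (δ * m) = K / (K + 1) / (4 * s₁) := by
    rw [hε]; field_simp
  have hb' : K * ε / (δ * m) < 1 / (4 * s₁) := by
    rw [hb]
    have : (K : ℝ) / (K + 1) < 1 := (div_lt_one (by positivity)).2 (by linarith)
    gcongr
  have hb2 : 1 / (2 * s₁) ≤ 1 / (s₁ - s) :=
    one_div_le_one_div_of_le (by linarith) (by linarith)
  have hb3 : 1 / (2 * s₁) = 1 / (4 * s₁) + 1 / (4 * s₁) := by field_simp; norm_num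
  rw [abs_le] at l1 l2
  linarith

/-- In a compact Ptolemy space in which any three points lie on a circle, geodesics do not branch in
the inversion at a generic point. -/
theorem PtolemySpace.exists_nonMerging [CompactSpace X] [Nonempty X] (hP : PtolemySpace X)
    (hL : HasInvLines X) : ∃ y : X, NonMerging y := by
  let u := TopologicalSpace.denseSeq X
  let F : ℕ × ℕ × ℕ × ℕ → Set X := fun i => {y : X | ∃ z z' q r,
    dist z (u i.2.2.1) ≤ 1 / ((i.2.1 : ℝ) + 1) ∧ dist z' (u i.2.2.2) ≤ 1 / ((i.2.1 : ℝ) + 1) ∧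
      MergingTuple (1 / ((i.1 : ℝ) + 1)) y z z' q r}
  have hF : ∀ i, IsClosed (F i) := fun i => isClosed_mergingTuple _ _ _ _
  -- Frontiers of closed sets are nowhere dense; off all of them, lying in some `F i` means lying in
  -- its interior.
  have hdense : Dense (⋂ i, (frontier (F i))ᶜ) := by
    refine dense_iInter_of_isOpen (fun i => isClosed_frontier.isOpen_compl) fun i => ?_
    rw [← interior_eq_empty_iff_dense_compl]
    exact interior_frontier (hF i)
  obtain ⟨y₀, hy₀⟩ := hdense.nonempty
  refine ⟨y₀, fun z₀ w q₀ r₀ hz hw hq hr hqr hb hb' heq => ?_⟩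
  by_contra hne
  obtain ⟨k, hk⟩ : ∃ k : ℕ, 1 / ((k : ℝ) + 1) < min (dist q₀ r₀)
      (min (dist z₀ y₀) (min (dist w y₀) (min (dist q₀ y₀) (dist r₀ y₀)))) := by
    refine exists_nat_one_div_lt ?_
    simp only [lt_min_iff, dist_pos]
    exact ⟨hqr, hz, hw, hq, hr⟩
  simp only [lt_min_iff] at hk
  obtain ⟨k1, k2, k3, k4, k5⟩ := hk
  have hT : MergingTuple (1 / ((k : ℝ) + 1)) y₀ z₀ w q₀ r₀ := by
    refine ⟨k1.le, k2.le, k3.le, k4.le, k5.le, hb, hb', ?_⟩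
    have := dist_pos.2 hz
    have := dist_pos.2 hw
    have := dist_pos.2 hq
    simp only [invDist] at heq
    field_simp at heq
    linarith
  refine hP.false_of_persistent_merging hL (δ := 1 / ((k : ℝ) + 1)) (by positivity) hne hz hw
    fun ε hε => ?_
  obtain ⟨l, hl⟩ := exists_nat_one_div_lt (half_pos hε)
  have hl0 : 0 < 1 / ((l : ℝ) + 1) := by positivity
  obtain ⟨i, hi⟩ := (TopologicalSpace.denseRange_denseSeq X).exists_dist_lt z₀ hl0
  obtain ⟨j, hj⟩ := (TopologicalSpace.denseRange_denseSeq X).exists_dist_lt w hl0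
  have hmem : y₀ ∈ F (k, l, i, j) := ⟨z₀, w, q₀, r₀, hi.le, hj.le, hT⟩
  have hnot : y₀ ∉ frontier (F (k, l, i, j)) := Set.mem_iInter.1 hy₀ _
  have hint : y₀ ∈ interior (F (k, l, i, j)) := by
    by_contra h
    exact hnot ⟨subset_closure hmem, h⟩
  filter_upwards [mem_interior_iff_mem_nhds.1 hint] with y hy
  obtain ⟨z, z', q, r, h1, h2, h3⟩ := hy
  refine ⟨z, z', q, r, ?_, ?_, h3⟩
  · have := dist_triangle_right z z₀ (u i)
    change dist z (u i) ≤ 1 / ((l : ℝ) + 1) at h1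
    change dist z₀ (u i) < _ at hi
    linarith
  · have := dist_triangle_right z' w (u j)
    change dist z' (u j) ≤ 1 / ((l : ℝ) + 1) at h2
    change dist w (u j) < _ at hj
    linarith

end Inversion

/-! ### From affine Busemann functions to Euclidean space. -/

section AffineFunctions

open Filter Topology

universe u

variable {Y : Type u} [MetricSpace Y]

/-- The Busemann function of a ray. -/
noncomputable def busemann (c : ℝ → Y) (x : Y) : ℝ := ⨅ n : ℕ, (dist x (c n) - n)

theorem tendsto_busemann {c : ℝ → Y} (hc : Isometry c) (x : Y) :
    Tendsto (fun n : ℕ => dist x (c n) - n) atTop (𝓝 (busemann c x)) := by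
  refine tendsto_atTop_ciInf ?_ ?_
  · refine antitone_nat_of_succ_le fun n => ?_
    have h1 := dist_triangle x (c n) (c (n + 1 : ℕ))
    rw [hc.dist_eq, Real.dist_eq] at h1
    push_cast at h1 ⊢
    rw [show (n : ℝ) - (n + 1) = -1 by ring, abs_neg, abs_one] at h1
    linarith
  · refine ⟨-dist x (c 0), ?_⟩
    rintro _ ⟨n, rfl⟩
    have h1 := dist_triangle_left (c 0) (c n) x
    rw [hc.dist_eq, Real.dist_eq, zero_sub, abs_neg, abs_of_nonneg (Nat.cast_nonneg n)] at h1
    change _ ≤ dist x (c n) - n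
    linarith

theorem busemann_apply_line {c : ℝ → Y} (hc : Isometry c) (t : ℝ) : busemann c (c t) = -t := by
  refine tendsto_nhds_unique (tendsto_busemann hc (c t)) (tendsto_const_nhds.congr' ?_)
  obtain ⟨N, hN⟩ := exists_nat_ge t
  filter_upwards [eventually_ge_atTop N] with n hn
  have : (N : ℝ) ≤ n := by exact_mod_cast hn
  rw [hc.dist_eq, Real.dist_eq, abs_of_nonpos (by linarith)]
  ring

theorem abs_busemann_sub_le {c : ℝ → Y} (hc : Isometry c) (x y : Y) :
    |busemann c x - busemann c y| ≤ dist x y := by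
  refine le_of_tendsto ((tendsto_busemann hc x).sub (tendsto_busemann hc y)).abs
    (Eventually.of_forall fun n => ?_)
  rw [sub_sub_sub_cancel_right]
  exact abs_dist_sub_le _ _ _

/-- `m` is a midpoint of `a` and `b`. -/
def IsMid (a b m : Y) : Prop := dist a m = dist a b / 2 ∧ dist b m = dist a b / 2

/-- Ptolemy for `m, c n, a, b` says that the distance from `c n` is convex at midpoints; this
survives the limit. -/
theorem PtolemySpace.busemann_mid_le (hP : PtolemySpace Y) {c : ℝ → Y} (hc : Isometry c)
    {a b m : Y} (hm : IsMid a b m) : 2 * busemann c m ≤ busemann c a + busemann c b := by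
  rcases eq_or_ne a b with rfl | hab
  · have : a = m := by
      rw [← dist_le_zero, hm.1, dist_self, zero_div]
    rw [this]; linarith
  refine le_of_tendsto_of_tendsto ((tendsto_busemann hc m).const_mul 2)
    ((tendsto_busemann hc a).add (tendsto_busemann hc b)) (Eventually.of_forall fun n => ?_)
  have := hP m (c n) a b
  have h0 := dist_pos.2 hab
  rw [dist_comm m a, dist_comm m b, hm.1, hm.2, dist_comm (c n) b, dist_comm (c n) a] at this
  change 2 * (dist m (c n) - n) ≤ dist a (c n) - n + (dist b (c n) - n)
  have h1 : dist a b * (2 * dist m (c n)) ≤ dist a b * (dist a (c n) + dist b (c n)) := by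
    linarith
  linarith [le_of_mul_le_mul_left h1 h0]

/-- Any two points lie on a line. -/
def HasLines (Y : Type*) [MetricSpace Y] : Prop :=
  ∀ a b : Y, a ≠ b → ∃ c : ℝ → Y, Isometry c ∧ c 0 = a ∧ c (dist a b) = b

/-- Geodesics that have a common piece do not branch. -/
def NonBranching (Y : Type*) [MetricSpace Y] : Prop :=
  ∀ z z' q r : Y, q ≠ r → dist z r = dist z q + dist q r → dist z' r = dist z' q + dist q r →
    dist z q = dist z' q → z = z'

/-- Busemann functions are concave at some midpoint. -/
def BusemannConcave (Y : Type*) [MetricSpace Y] : Prop :=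
  ∀ a b : Y, a ≠ b → ∀ c : ℝ → Y, Isometry c →
    ∃ m, IsMid a b m ∧ busemann c a + busemann c b ≤ 2 * busemann c m

theorem NonBranching.mid_unique (hN : NonBranching Y) (hL : HasLines Y) {a b m m' : Y}
    (hm : IsMid a b m) (hm' : IsMid a b m') : m = m' := by
  rcases eq_or_ne a b with rfl | hab
  · have h1 : a = m := by rw [← dist_le_zero, hm.1, dist_self, zero_div]
    have h2 : a = m' := by rw [← dist_le_zero, hm'.1, dist_self, zero_div]
    exact h1.symm.trans h2
  obtain ⟨c, hc, h0, h1⟩ := hL a b hab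
  -- Beyond `b`, so that geodesics through two midpoints would share the piece from `b` to `r`.
  set r := c (dist a b + 1) with hr
  have har : dist a r = dist a b + 1 := by
    rw [← h0, hr, hc.dist_eq, Real.dist_eq, zero_sub, abs_neg, h0, abs_of_nonneg (by positivity)]
  have hbr : dist b r = 1 := by
    have : dist (c (dist a b)) r = 1 := by
      rw [hr, hc.dist_eq, Real.dist_eq, sub_add_cancel_left, abs_neg, abs_one]
    rwa [h1] at this
  have key : ∀ m, IsMid a b m → dist m r = dist m b + dist b r := by
    intro m hm
    refine le_antisymm (dist_triangle _ _ _) ?_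
    have := dist_triangle a m r
    rw [har, hm.1] at this
    rw [dist_comm m b, hm.2, hbr]
    linarith
  refine hN m m' b r (dist_pos.1 (by rw [hbr]; norm_num)) (key m hm) (key m' hm') ?_
  rw [dist_comm m, dist_comm m', hm.2, hm'.2]

/-- Normalized real valued nonexpanding functions that are affine along geodesics. -/
structure IsAffineFunction (o : Y) (f : Y → ℝ) : Prop where
  base : f o = 0
  lip : ∀ x y, |f x - f y| ≤ dist x y
  mid : ∀ a b m, IsMid a b m → 2 * f m = f a + f b

theorem exists_isAffineFunction (hP : PtolemySpace Y) (hL : HasLines Y) (hN : NonBranching Y)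
    (hB : BusemannConcave Y) (o a b : Y) :
    ∃ f : Y → ℝ, IsAffineFunction o f ∧ dist a b ≤ |f a - f b| := by
  rcases eq_or_ne a b with rfl | hab
  · exact ⟨0, ⟨rfl, by simp, by simp⟩, by simp⟩
  obtain ⟨c, hc, h0, h1⟩ := hL a b hab
  refine ⟨fun x => busemann c x - busemann c o, ⟨sub_self _, fun x y => ?_, fun a b m hm => ?_⟩, ?_⟩
  · rw [sub_sub_sub_cancel_right]
    exact abs_busemann_sub_le hc x y
  · have hle := hP.busemann_mid_le hc hm
    rcases eq_or_ne a b with rfl | hab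
    · have : a = m := by rw [← dist_le_zero, hm.1, dist_self, zero_div]
      rw [this]; ring
    obtain ⟨m', hm', hge⟩ := hB a b hab c hc
    rw [← hN.mid_unique hL hm hm'] at hge
    linarith
  · rw [sub_sub_sub_cancel_right]
    have e1 : busemann c a = 0 := by rw [← h0, busemann_apply_line hc, neg_zero]
    have e2 : busemann c b = -dist a b := by
      have := busemann_apply_line hc (dist a b)
      rwa [h1] at this
    rw [e1, e2, zero_sub, neg_neg]
    exact le_abs_self _

/-- Midpoint affinity with value zero at the origin makes `f ∘ c` additive, and a continuous
additive function is linear. -/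
theorem IsAffineFunction.apply_line {o : Y} {f : Y → ℝ} (hf : IsAffineFunction o f) {c : ℝ → Y}
    (hc : Isometry c) (h0 : c 0 = o) (r t : ℝ) : f (c (r * t)) = r * f (c t) := by
  have hmid : ∀ s t, 2 * f (c ((s + t) / 2)) = f (c s) + f (c t) := by
    intro s t
    refine hf.mid _ _ _ ⟨?_, ?_⟩
    · rw [hc.dist_eq, hc.dist_eq, Real.dist_eq, Real.dist_eq,
        show s - (s + t) / 2 = (s - t) / 2 by ring, abs_div, abs_two]
    · rw [hc.dist_eq, hc.dist_eq, Real.dist_eq, Real.dist_eq,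
        show t - (s + t) / 2 = -((s - t) / 2) by ring, abs_neg, abs_div, abs_two]
  have hz : f (c 0) = 0 := by rw [h0, hf.base]
  have hdouble : ∀ t, 2 * f (c t) = f (c (2 * t)) := by
    intro t
    have := hmid (2 * t) 0
    rw [hz, add_zero, add_zero, mul_div_cancel_left₀ _ (two_ne_zero' ℝ)] at this
    exact this
  let g : ℝ →+ ℝ :=
    { toFun := fun t => f (c t)
      map_zero' := hz
      map_add' := fun s t => by
        have h1 := hmid (2 * s) (2 * t)
        rw [← mul_add, mul_div_cancel_left₀ _ (two_ne_zero' ℝ), ← hdouble, ← hdouble] at h1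
        linarith }
  have hg : Continuous g := by
    have : LipschitzWith 1 g := LipschitzWith.of_dist_le_mul fun s t => by
      rw [NNReal.coe_one, one_mul]
      change |f (c s) - f (c t)| ≤ dist s t
      rw [← hc.dist_eq]
      exact hf.lip _ _
    exact this.continuous
  exact map_real_smul g hg r t

theorem HasLines.exists_isMid (hL : HasLines Y) (a b : Y) : ∃ m, IsMid a b m := by
  rcases eq_or_ne a b with rfl | hab
  · exact ⟨a, by simp [IsMid]⟩
  obtain ⟨c, hc, h0, h1⟩ := hL a b hab
  set D := dist a b with hD
  have hD0 : 0 ≤ D := dist_nonneg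
  refine ⟨c (D / 2), ?_, ?_⟩
  · rw [← h0, hc.dist_eq, Real.dist_eq, zero_sub, abs_neg, h0, abs_of_nonneg (by positivity)]
  · have : dist (c D) (c (D / 2)) = D / 2 := by
      rw [hc.dist_eq, Real.dist_eq, abs_of_nonneg (by linarith)]
      ring
    rwa [h1] at this

theorem exists_isometryEquiv_normedSpace (hP : PtolemySpace Y) (hL : HasLines Y)
    (hN : NonBranching Y) (hB : BusemannConcave Y) (o : Y) :
    ∃ (V : Type u) (_ : NormedAddCommGroup V) (_ : NormedSpace ℝ V), Nonempty (Y ≃ᵢ V) := by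
  let H := {f : Y → ℝ // IsAffineFunction o f}
  -- The discrete topology makes every bounded function on `H` continuous, so that only the sup norm
  -- matters.
  let _ : TopologicalSpace H := ⊥
  have : DiscreteTopology H := ⟨rfl⟩
  let Φ : Y → BoundedContinuousFunction H ℝ := fun x =>
    BoundedContinuousFunction.mkOfDiscrete (fun f => f.1 x) (2 * dist x o) fun f g => by
      have h1 := f.2.lip x o
      have h2 := g.2.lip x o
      rw [f.2.base, sub_zero] at h1
      rw [g.2.base, sub_zero] at h2
      rw [Real.dist_eq]
      have := abs_sub (f.1 x) (g.1 x)
      linarith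
  have hΦ : ∀ x (f : H), Φ x f = f.1 x := fun x f => rfl
  have hiso : Isometry Φ := by
    refine Isometry.of_dist_eq fun a b => le_antisymm ?_ ?_
    · refine (BoundedContinuousFunction.dist_le dist_nonneg).2 fun f => ?_
      rw [hΦ, hΦ, Real.dist_eq]
      exact f.2.lip a b
    · obtain ⟨f, hf, hab⟩ := exists_isAffineFunction hP hL hN hB o a b
      refine hab.trans ?_
      have := BoundedContinuousFunction.dist_coe_le_dist (f := Φ a) (g := Φ b) ⟨f, hf⟩
      rwa [hΦ, hΦ, Real.dist_eq] at this
  have hzero : Φ o = 0 := by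
    ext f
    exact f.2.base
  have hsmul : ∀ (r : ℝ) (a : Y), ∃ b, Φ b = r • Φ a := by
    intro r a
    rcases eq_or_ne o a with rfl | ha
    · exact ⟨o, by rw [hzero, smul_zero]⟩
    obtain ⟨c, hc, h0, h1⟩ := hL o a ha
    refine ⟨c (r * dist o a), ?_⟩
    ext f
    rw [hΦ, f.2.apply_line hc h0, h1]
    rfl
  let W : Submodule ℝ (BoundedContinuousFunction H ℝ) :=
    { carrier := Set.range Φ
      zero_mem' := ⟨o, hzero⟩
      add_mem' := by
        rintro _ _ ⟨a, rfl⟩ ⟨b, rfl⟩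
        -- The sum is twice the midpoint.
        obtain ⟨m, hm⟩ := hL.exists_isMid a b
        obtain ⟨d, hd⟩ := hsmul 2 m
        refine ⟨d, hd.trans ?_⟩
        ext f
        exact f.2.mid a b m hm
      smul_mem' := by
        rintro r _ ⟨a, rfl⟩
        exact hsmul r a }
  let e : Y ≃ W := Equiv.ofBijective (fun x => ⟨Φ x, x, rfl⟩)
    ⟨fun a b h => hiso.injective (congrArg Subtype.val h), by
      rintro ⟨_, x, rfl⟩
      exact ⟨x, rfl⟩⟩
  exact ⟨W, inferInstance, inferInstance, ⟨⟨e, fun a b => hiso a b⟩⟩⟩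

theorem exists_isometryEquiv_euclideanSpace [ProperSpace Y] [Nontrivial Y] (hP : PtolemySpace Y)
    (hL : HasLines Y) (hN : NonBranching Y) (hB : BusemannConcave Y) :
    ∃ n : ℕ, 1 ≤ n ∧ Nonempty (Y ≃ᵢ EuclideanSpace ℝ (Fin n)) := by
  obtain ⟨o⟩ := (inferInstance : Nonempty Y)
  obtain ⟨V, _, _, ⟨e⟩⟩ := exists_isometryEquiv_normedSpace hP hL hN hB o
  have hdist : ∀ u v : V, dist (e.symm u) (e.symm v) = ‖u - v‖ := fun u v => by
    rw [e.symm.dist_eq, dist_eq_norm]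
  have hV : ∀ u v : V, ‖u + v‖ * ‖u - v‖ ≤ ‖u‖ ^ 2 + ‖v‖ ^ 2 := by
    intro u v
    -- The four vertices of the parallelogram spanned by `u` and `v`.
    have := hP (e.symm 0) (e.symm (u + v)) (e.symm v) (e.symm u)
    simp only [hdist, zero_sub, norm_neg, add_sub_cancel_right, add_sub_cancel_left] at this
    rw [norm_sub_rev v u] at this
    linarith
  let _ : InnerProductSpace ℝ V := InnerProductSpace.ofNorm ℝ (parallelogram_of_ptolemy hV)
  have : ProperSpace V := by
    refine ⟨fun x r => ?_⟩
    have := (isCompact_closedBall (e.symm x) r).image e.continuous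
    rwa [e.image_closedBall, e.apply_symm_apply] at this
  have : FiniteDimensional ℝ V := FiniteDimensional.of_locallyCompactSpace ℝ
  have : Nontrivial V := e.toEquiv.symm.nontrivial
  exact ⟨Module.finrank ℝ V, Module.finrank_pos,
    ⟨e.trans (stdOrthonormalBasis ℝ V).repr.toIsometryEquiv⟩⟩

end AffineFunctions

/-! ### The inverted space: properness and concavity of Busemann functions. -/

section InvSpace

open Filter Topology

universe u

variable {X : Type u} [MetricSpace X]

/-- The complement of the point `y` in a Ptolemy space, with the metric obtained by inversion at
`y`. -/
def InvSpace (_ : PtolemySpace X) (y : X) : Type u := {x : X // x ≠ y}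

variable {hP : PtolemySpace X} {y : X}

theorem PtolemySpace.invDist_triangle (hP : PtolemySpace X) {y a b d : X} (ha : a ≠ y) (hb : b ≠ y)
    (hd : d ≠ y) : invDist y a d ≤ invDist y a b + invDist y b d := by
  have h1 := dist_pos.2 ha
  have h2 := dist_pos.2 hb
  have h3 := dist_pos.2 hd
  have := hP a d b y
  simp only [invDist]
  rw [div_add_div _ _ (by positivity) (by positivity), div_le_div_iff₀ (by positivity)
    (by positivity)]
  rw [dist_comm d b] at this
  have h4 : 0 ≤ dist a y * dist b y * dist d y := by positivity
  linarith [mul_le_mul_of_nonneg_left this h4]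

noncomputable instance : MetricSpace (InvSpace hP y) where
  dist a b := invDist y a.1 b.1
  dist_self a := by simp [invDist]
  dist_comm a b := invDist_comm y a.1 b.1
  dist_triangle a b d := hP.invDist_triangle a.2 b.2 d.2
  eq_of_dist_eq_zero {a b} h := by
    by_contra hab
    exact (invDist_pos a.2 b.2 fun h' => hab (Subtype.ext h')).ne' h

theorem InvSpace.dist_coe (a b : InvSpace hP y) :
    dist a.1 b.1 = dist a b * (dist a.1 y * dist b.1 y) := dist_eq_invDist_mul a.2 b.2

theorem InvSpace.ptolemySpace : PtolemySpace (InvSpace hP y) := by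
  intro a b c d
  have h := hP a.1 b.1 c.1 d.1
  simp only [InvSpace.dist_coe] at h
  have ha := dist_pos.2 a.2
  have hb := dist_pos.2 b.2
  have hc := dist_pos.2 c.2
  have hd := dist_pos.2 d.2
  have hpos : 0 < dist a.1 y * dist b.1 y * dist c.1 y * dist d.1 y := by positivity
  refine le_of_mul_le_mul_left ?_ hpos
  linarith

theorem InvSpace.hasLines (hL : HasInvLines X) : HasLines (InvSpace hP y) := by
  intro a b hab
  obtain ⟨c, hc, hiso, h0, h1⟩ := hL y a.1 b.1 a.2 b.2 fun h => hab (Subtype.ext h)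
  exact ⟨fun t => ⟨c t, hc t⟩, Isometry.of_dist_eq fun s t => hiso s t, Subtype.ext h0,
    Subtype.ext h1⟩

theorem NonMerging.nonBranching (hy : NonMerging y) : NonBranching (InvSpace hP y) := by
  intro z z' q r hqr h h' heq
  exact Subtype.ext (hy z.1 z'.1 q.1 r.1 z.2 z'.2 q.2 r.2 (fun h => hqr (Subtype.ext h))
    (invBetween_of_invDist_eq z.2 q.2 r.2 h) (invBetween_of_invDist_eq z'.2 q.2 r.2 h') heq)

theorem tendsto_invDist {ι : Type*} {l : Filter ι} {u v : ι → X} {a b : X} (ha : a ≠ y)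
    (hb : b ≠ y) (hu : Tendsto u l (𝓝 a)) (hv : Tendsto v l (𝓝 b)) :
    Tendsto (fun i => invDist y (u i) (v i)) l (𝓝 (invDist y a b)) :=
  (hu.dist hv).div ((hu.dist tendsto_const_nhds).mul (hv.dist tendsto_const_nhds))
    (mul_pos (dist_pos.2 ha) (dist_pos.2 hb)).ne'

/-- Limits taken in the compact space `X` cannot be `y`, because the inverted distance from `a`
would blow up there. -/
instance [CompactSpace X] : ProperSpace (InvSpace hP y) where
  isCompact_closedBall a r := by
    rw [isCompact_iff_isSeqCompact]
    intro x hx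
    obtain ⟨z, -, φ, hφ, hz⟩ := (isCompact_univ : IsCompact (Set.univ : Set X)).tendsto_subseq
      (fun n => Set.mem_univ (x n).1)
    have hle : ∀ n, dist (x n).1 a.1 ≤ r * (dist (x n).1 y * dist a.1 y) := fun n => by
      rw [InvSpace.dist_coe]
      exact mul_le_mul_of_nonneg_right (hx n) (by positivity)
    have hlim : dist z a.1 ≤ r * (dist z y * dist a.1 y) :=
      le_of_tendsto_of_tendsto (hz.dist tendsto_const_nhds)
        (((hz.dist tendsto_const_nhds).mul_const _).const_mul r)
        (Eventually.of_forall fun n => hle (φ n))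
    have hzy : z ≠ y := by
      rintro rfl
      rw [dist_self, zero_mul, mul_zero] at hlim
      exact a.2 (dist_le_zero.1 hlim).symm
    let Z : InvSpace hP y := ⟨z, hzy⟩
    refine ⟨Z, ?_, φ, hφ, ?_⟩
    · have h0 := mul_pos (dist_pos.2 hzy) (dist_pos.2 a.2)
      exact (div_le_iff₀ h0).2 hlim
    · rw [tendsto_iff_dist_tendsto_zero]
      have := tendsto_invDist hzy hzy hz (tendsto_const_nhds (x := z))
      rwa [show invDist y z z = 0 by simp [invDist]] at this

theorem InvSpace.tendsto_line [CompactSpace X] {c : ℝ → InvSpace hP y} (hc : Isometry c) :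
    Tendsto (fun n : ℕ => (c n).1) atTop (𝓝 y) := by
  obtain ⟨R, hR⟩ := Metric.isBounded_iff.1 (isCompact_univ : IsCompact (Set.univ : Set X)).isBounded
  have h0 := dist_pos.2 (c 0).2
  rw [tendsto_iff_dist_tendsto_zero]
  refine squeeze_zero' (Eventually.of_forall fun n => dist_nonneg) ?_
    (tendsto_const_div_atTop_nhds_zero_nat (R / dist (c 0).1 y))
  filter_upwards [eventually_gt_atTop 0] with n hn
  have hn' : (0 : ℝ) < n := by exact_mod_cast hn
  have h1 := InvSpace.dist_coe (c n) (c 0)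
  rw [hc.dist_eq, Real.dist_eq, sub_zero, abs_of_pos hn'] at h1
  have h2 := hR (Set.mem_univ (c n).1) (Set.mem_univ (c 0).1)
  rw [h1] at h2
  rw [le_div_iff₀ hn', le_div_iff₀ h0]
  linarith

theorem HasInvLines.exists_mid (hL : HasInvLines X) {a b p : X} (hap : a ≠ p) (hbp : b ≠ p)
    (hab : a ≠ b) : ∃ m, 2 * (dist a m * dist b p) = dist a b * dist m p ∧
      2 * (dist b m * dist a p) = dist a b * dist m p := by
  obtain ⟨c, hc, hiso, h0, h1⟩ := hL p a b hap hbp hab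
  set D := invDist p a b with hD
  have hD0 : 0 < D := invDist_pos hap hbp hab
  refine ⟨c (D / 2), ?_, ?_⟩
  · have := hiso 0 (D / 2)
    rw [h0, zero_sub, abs_neg, abs_of_pos (half_pos hD0)] at this
    rw [dist_eq_invDist_mul hap (hc _), this, dist_eq_invDist_mul hap hbp, ← hD]
    ring
  · have := hiso D (D / 2)
    rw [h1, abs_of_pos (by linarith)] at this
    rw [dist_eq_invDist_mul hbp (hc _), this, dist_eq_invDist_mul hap hbp, ← hD]
    ring

/-- Midpoints of `a, b` in the inversions at `c n` subconverge to a midpoint in the inversion at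
`y`. Their defining equations give a Ptolemy equality with `c n`, whose limit is the reverse of the
convexity inequality. -/
theorem InvSpace.busemannConcave [CompactSpace X] (hL : HasInvLines X) :
    BusemannConcave (InvSpace hP y) := by
  intro a b hab c hc
  have habX : a.1 ≠ b.1 := fun h => hab (Subtype.ext h)
  have hex : ∀ n : ℕ, ∃ m : X, a ≠ c n → b ≠ c n →
      -- The midpoint equations with denominators cleared, so that they remain meaningful in the
      -- limit `c n → y`.
      2 * (dist a.1 m * dist b.1 (c n).1) = dist a.1 b.1 * dist m (c n).1 ∧
        2 * (dist b.1 m * dist a.1 (c n).1) = dist a.1 b.1 * dist m (c n).1 := by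
    intro n
    by_cases h1 : a = c n
    · exact ⟨a.1, fun h => absurd h1 h⟩
    by_cases h2 : b = c n
    · exact ⟨a.1, fun _ h => absurd h2 h⟩
    obtain ⟨m, hm⟩ := hL.exists_mid (p := (c n).1) (fun h => h1 (Subtype.ext h))
      (fun h => h2 (Subtype.ext h)) habX
    exact ⟨m, fun _ _ => hm⟩
  choose μ hμ using hex
  have hne : ∀ a : InvSpace hP y, ∀ᶠ n : ℕ in atTop, a ≠ c n := by
    intro a
    obtain ⟨N, hN⟩ := exists_nat_gt (dist a (c 0))
    filter_upwards [eventually_ge_atTop N] with n hn h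
    have : (N : ℝ) ≤ n := by exact_mod_cast hn
    rw [h, hc.dist_eq, Real.dist_eq, sub_zero, abs_of_nonneg (Nat.cast_nonneg n)] at hN
    linarith
  obtain ⟨m, -, φ, hφ, hlim⟩ := (isCompact_univ : IsCompact (Set.univ : Set X)).tendsto_subseq
    (fun n => Set.mem_univ (μ n))
  have hφ' := hφ.tendsto_atTop
  have hp : Tendsto (fun n => (c (φ n)).1) atTop (𝓝 y) := (InvSpace.tendsto_line hc).comp hφ'
  have hev : ∀ᶠ n in atTop,
      2 * (dist a.1 (μ (φ n)) * dist b.1 (c (φ n)).1) =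
        dist a.1 b.1 * dist (μ (φ n)) (c (φ n)).1 ∧
      2 * (dist b.1 (μ (φ n)) * dist a.1 (c (φ n)).1) =
        dist a.1 b.1 * dist (μ (φ n)) (c (φ n)).1 := by
    filter_upwards [hφ'.eventually (hne a), hφ'.eventually (hne b)] with n h1 h2
    exact hμ _ h1 h2
  have hm1 : 2 * (dist a.1 m * dist b.1 y) = dist a.1 b.1 * dist m y :=
    tendsto_nhds_unique_of_eventuallyEq
      (((tendsto_const_nhds.dist hlim).mul (tendsto_const_nhds.dist hp)).const_mul 2)
      ((hlim.dist hp).const_mul _) (hev.mono fun n h => h.1)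
  have hm2 : 2 * (dist b.1 m * dist a.1 y) = dist a.1 b.1 * dist m y :=
    tendsto_nhds_unique_of_eventuallyEq
      (((tendsto_const_nhds.dist hlim).mul (tendsto_const_nhds.dist hp)).const_mul 2)
      ((hlim.dist hp).const_mul _) (hev.mono fun n h => h.2)
  have ha := dist_pos.2 a.2
  have hb := dist_pos.2 b.2
  have hmy : m ≠ y := by
    rintro rfl
    rw [dist_self, mul_zero] at hm1
    have := mul_pos ha hb
    linarith
  have hm0 := dist_pos.2 hmy
  have hmid : IsMid a b (⟨m, hmy⟩ : InvSpace hP y) := by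
    constructor
    · change invDist y a.1 m = invDist y a.1 b.1 / 2
      simp only [invDist]
      field_simp
      linarith
    · change invDist y b.1 m = invDist y a.1 b.1 / 2
      simp only [invDist]
      field_simp
      linarith
  refine ⟨⟨m, hmy⟩, hmid, ?_⟩
  set M : InvSpace hP y := ⟨m, hmy⟩
  set L := dist a b with hLdef
  have hL0 : 0 < L := dist_pos.2 hab
  have t1 : Tendsto (fun n => invDist y a.1 (μ (φ n))) atTop (𝓝 (L / 2)) := by
    rw [← hmid.1]
    exact tendsto_invDist a.2 hmy tendsto_const_nhds hlim
  have t2 : Tendsto (fun n => invDist y b.1 (μ (φ n))) atTop (𝓝 (L / 2)) := by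
    rw [← hmid.2]
    exact tendsto_invDist b.2 hmy tendsto_const_nhds hlim
  have t3 : Tendsto (fun n => invDist y m (μ (φ n))) atTop (𝓝 0) := by
    have := tendsto_invDist hmy hmy (tendsto_const_nhds (x := m)) hlim
    rwa [show invDist y m m = 0 by simp [invDist]] at this
  have ta := (tendsto_busemann hc a).comp hφ'
  have tb := (tendsto_busemann hc b).comp hφ'
  have tm := (tendsto_busemann hc M).comp hφ'
  -- Before the limit, the term `L * 0` is the cost of replacing the approximating midpoint by `M`.
  have hfin : L / 2 * busemann c b + L / 2 * busemann c a - L * 0 ≤ L * busemann c M := by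
    refine le_of_tendsto_of_tendsto (((t1.mul tb).add (t2.mul ta)).sub (t3.const_mul L))
      (tm.const_mul L) ?_
    filter_upwards [hev, hlim.eventually_ne hmy] with n hn hny
    simp only [Function.comp_apply] at hny ⊢
    set k := φ n
    set q : InvSpace hP y := ⟨μ k, hny⟩
    change dist a q * (dist b (c k) - k) + dist b q * (dist a (c k) - k) - L * dist M q ≤
      L * (dist M (c k) - k)
    have hq0 : 0 < dist q.1 y := dist_pos.2 q.2
    have hk0 : 0 < dist (c k).1 y := dist_pos.2 (c k).2
    have e1 : 2 * (dist a q * dist b (c k)) = L * dist q (c k) := by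
      have := hn.1
      change 2 * (dist a.1 q.1 * dist b.1 (c k).1) = dist a.1 b.1 * dist q.1 (c k).1 at this
      simp only [InvSpace.dist_coe] at this
      have h0 : 0 < dist a.1 y * dist b.1 y * dist q.1 y * dist (c k).1 y := by positivity
      refine mul_left_cancel₀ h0.ne' ?_
      linear_combination this
    have e2 : 2 * (dist b q * dist a (c k)) = L * dist q (c k) := by
      have := hn.2
      change 2 * (dist b.1 q.1 * dist a.1 (c k).1) = dist a.1 b.1 * dist q.1 (c k).1 at this
      simp only [InvSpace.dist_coe] at this
      have h0 : 0 < dist a.1 y * dist b.1 y * dist q.1 y * dist (c k).1 y := by positivity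
      refine mul_left_cancel₀ h0.ne' ?_
      linear_combination this
    have e3 : L ≤ dist a q + dist b q := dist_triangle_right _ _ _
    have e4 : dist q (c k) ≤ dist M q + dist M (c k) := dist_triangle_left _ _ _
    have e5 : (0 : ℝ) ≤ k := Nat.cast_nonneg k
    have e6 := mul_le_mul_of_nonneg_right e3 e5
    have e7 := mul_le_mul_of_nonneg_left e4 hL0.le
    linarith
  have : L * (busemann c a + busemann c b) ≤ L * (2 * busemann c M) := by linarith
  exact le_of_mul_le_mul_left this hL0

/-- A compact Ptolemy space in which any three points lie on a circle is a Euclidean space, after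
inversion at a suitable point. -/
theorem PtolemySpace.exists_euclidean [CompactSpace X] (hP : PtolemySpace X) (hL : HasInvLines X)
    (hthree : ∃ x y z : X, x ≠ y ∧ x ≠ z ∧ y ≠ z) :
    ∃ (y : X) (n : ℕ), 1 ≤ n ∧ ∃ e : {x : X // x ≠ y} ≃ EuclideanSpace ℝ (Fin n),
      ∀ a b, dist (e a) (e b) = invDist y a.1 b.1 := by
  obtain ⟨x₁, x₂, x₃, h12, h13, h23⟩ := hthree
  have : Nonempty X := ⟨x₁⟩
  obtain ⟨y, hy⟩ := hP.exists_nonMerging hL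
  have : Nontrivial (InvSpace hP y) := by
    by_cases h1 : x₁ = y
    · exact ⟨⟨x₂, fun h => h12 (h1.trans h.symm)⟩, ⟨x₃, fun h => h13 (h1.trans h.symm)⟩,
        fun h => h23 (congrArg Subtype.val h)⟩
    · by_cases h2 : x₂ = y
      · exact ⟨⟨x₁, h1⟩, ⟨x₃, fun h => h23 (h2.trans h.symm)⟩,
          fun h => h13 (congrArg Subtype.val h)⟩
      · exact ⟨⟨x₁, h1⟩, ⟨x₂, h2⟩, fun h => h12 (congrArg Subtype.val h)⟩
  obtain ⟨n, hn, ⟨e⟩⟩ := exists_isometryEquiv_euclideanSpace (Y := InvSpace hP y)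
    InvSpace.ptolemySpace (InvSpace.hasLines hL) hy.nonBranching (InvSpace.busemannConcave hL)
  exact ⟨y, n, hn, e.toEquiv, fun a b => e.dist_eq a b⟩

end InvSpace

/-! ### Arcs through the center of inversion become lines. -/

section CircleToLine

open Filter Topology Set

variable {X : Type*} [MetricSpace X]

/-- A closed curve through `w` along which the inverted distance is additive is a line in the
inversion at `w`. -/
theorem exists_line_of_additive {w : X} {γ : ℝ → X} {T : ℝ} (hT : 0 < T) (hγ : Continuous γ)
    (h0 : γ 0 = w) (h1 : γ T = w) (hne : ∀ t ∈ Ioo 0 T, γ t ≠ w)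
    (hadd : ∀ s t u, 0 < s → s < t → t < u → u < T →
      invDist w (γ s) (γ u) = invDist w (γ s) (γ t) + invDist w (γ t) (γ u))
    {a b : ℝ} (ha : a ∈ Ioo 0 T) (hb : b ∈ Ioo 0 T) :
    ∃ c : ℝ → X, (∀ t, c t ≠ w) ∧ (∀ s t, invDist w (c s) (c t) = |s - t|) ∧ c 0 = γ a ∧
      c (invDist w (γ a) (γ b)) = γ b := by
  set o := T / 2 with ho
  have hoI : o ∈ Ioo 0 T := ⟨half_pos hT, half_lt_self hT⟩
  have hself : ∀ x : X, invDist w x x = 0 := fun x => by simp [invDist]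
  have hnonneg : ∀ x y : X, 0 ≤ invDist w x y := fun x y => by unfold invDist; positivity
  -- Signed arc length from the parameter midpoint; it is unbounded on both sides because `γ` tends
  -- to `w` at both ends.
  let ψ : ℝ → ℝ := fun t => if o ≤ t then invDist w (γ o) (γ t) else -invDist w (γ t) (γ o)
  have hψ : ∀ s ∈ Ioo 0 T, ∀ t ∈ Ioo 0 T, s < t → ψ t - ψ s = invDist w (γ s) (γ t) := by
    intro s hs t ht hst
    simp only [ψ]
    by_cases h2 : o ≤ s
    · rw [if_pos (h2.trans hst.le), if_pos h2]
      rcases h2.eq_or_lt with h3 | h3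
      · rw [← h3, hself, sub_zero]
      · rw [hadd o s t hoI.1 h3 hst ht.2]; ring
    · push Not at h2
      rw [if_neg (not_le.2 h2)]
      by_cases h3 : o ≤ t
      · rw [if_pos h3]
        rcases h3.eq_or_lt with h4 | h4
        · rw [← h4, hself]; ring
        · rw [hadd s o t hs.1 h2 h4 ht.2]; ring
      · push Not at h3
        rw [if_neg (not_le.2 h3), hadd s t o hs.1 hst h3 hoI.2]; ring
  have habs : ∀ s ∈ Ioo 0 T, ∀ t ∈ Ioo 0 T, invDist w (γ s) (γ t) = |ψ s - ψ t| := by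
    intro s hs t ht
    rcases lt_trichotomy s t with h | h | h
    · rw [← hψ s hs t ht h, abs_of_nonpos]
      · ring
      · have := hψ s hs t ht h
        have := hnonneg (γ s) (γ t)
        linarith
    · rw [h, hself, sub_self, abs_zero]
    · rw [invDist_comm, ← hψ t ht s hs h, abs_of_nonneg]
      have := hψ t ht s hs h
      have := hnonneg (γ t) (γ s)
      linarith
  have hcont : ContinuousOn ψ (Ioo 0 T) := by
    intro s hs
    refine ContinuousAt.continuousWithinAt ?_
    rw [ContinuousAt, tendsto_iff_dist_tendsto_zero]
    have hlim : Tendsto (fun t => invDist w (γ t) (γ s)) (𝓝 s) (𝓝 0) := by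
      have := tendsto_invDist (hne s hs) (hne s hs) (hγ.tendsto s) (tendsto_const_nhds (x := γ s))
      rwa [hself] at this
    refine hlim.congr' ?_
    filter_upwards [Ioo_mem_nhds hs.1 hs.2] with t ht
    rw [habs t ht s hs, Real.dist_eq]
  have hend : ∀ (l : Filter ℝ) (e : ℝ), γ e = w → l ≤ 𝓝 e → (∀ᶠ t in l, t ∈ Ioo 0 T) →
      Tendsto (fun t => invDist w (γ o) (γ t)) l atTop := by
    intro l e he hl hmem
    have hlim : Tendsto γ l (𝓝 w) := he ▸ (hγ.tendsto e).mono_left hl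
    have hpos := dist_pos.2 (hne o hoI)
    have hden : Tendsto (fun t => dist (γ o) w * dist (γ t) w) l (𝓝[>] 0) := by
      refine tendsto_nhdsWithin_iff.2 ⟨?_, ?_⟩
      · have := (hlim.dist (tendsto_const_nhds (x := w))).const_mul (dist (γ o) w)
        rwa [dist_self, mul_zero] at this
      · filter_upwards [hmem] with t ht using mul_pos hpos (dist_pos.2 (hne t ht))
    exact Tendsto.pos_mul_atTop hpos (tendsto_const_nhds.dist hlim)
      (tendsto_inv_nhdsGT_zero.comp hden)
  have hsurj : ∀ r : ℝ, ∃ t ∈ Ioo 0 T, ψ t = r := by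
    intro r
    have hr := hend (𝓝[<] T) T h1 nhdsWithin_le_nhds (Ioo_mem_nhdsLT hT)
    have hl := hend (𝓝[>] 0) 0 h0 nhdsWithin_le_nhds (Ioo_mem_nhdsGT hT)
    obtain ⟨t₂, ht₂, ht₂'⟩ := ((hr.eventually_ge_atTop r).and (Ioo_mem_nhdsLT hoI.2)).exists
    obtain ⟨t₁, ht₁, ht₁'⟩ := ((hl.eventually_ge_atTop (-r)).and (Ioo_mem_nhdsGT hoI.1)).exists
    have m2 : t₂ ∈ Ioo 0 T := ⟨hoI.1.trans ht₂'.1, ht₂'.2⟩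
    have m1 : t₁ ∈ Ioo 0 T := ⟨ht₁'.1, ht₁'.2.trans hoI.2⟩
    have e2 : r ≤ ψ t₂ := by
      simp only [ψ, if_pos ht₂'.1.le]; exact ht₂
    have e1 : ψ t₁ ≤ r := by
      simp only [ψ, if_neg (not_le.2 ht₁'.2)]
      rw [invDist_comm]
      linarith
    obtain ⟨t, ht, hteq⟩ := isPreconnected_Ioo.intermediate_value m1 m2 hcont ⟨e1, e2⟩
    exact ⟨t, ht, hteq⟩
  choose τ hτ hψτ using hsurj
  have hτγ : ∀ t ∈ Ioo 0 T, γ (τ (ψ t)) = γ t := by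
    intro t ht
    by_contra hcon
    have := invDist_pos (hne _ (hτ (ψ t))) (hne t ht) hcon
    rw [habs _ (hτ _) t ht, hψτ, sub_self, abs_zero] at this
    exact this.false
  -- The orientation that places `γ b` at a positive parameter.
  obtain ⟨ε, hε, hεab⟩ : ∃ ε : ℝ, |ε| = 1 ∧ ε * |ψ a - ψ b| = ψ b - ψ a := by
    rcases le_total (ψ a) (ψ b) with h | h
    · exact ⟨1, abs_one, by rw [abs_of_nonpos (by linarith)]; ring⟩
    · exact ⟨-1, by simp, by rw [abs_of_nonneg (by linarith)]; ring⟩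
  refine ⟨fun r => γ (τ (ψ a + ε * r)), fun r => hne _ (hτ _), fun r s => ?_, ?_, ?_⟩
  · rw [habs _ (hτ _) _ (hτ _), hψτ, hψτ, add_sub_add_left_eq_sub, ← mul_sub, abs_mul, hε, one_mul]
  · simp only [mul_zero, add_zero]
    exact hτγ a ha
  · simp only [habs a ha b hb, hεab, add_sub_cancel]
    exact hτγ b hb

end CircleToLine

/-! ### Removing the remote point, and lines from circles. -/

namespace ExtendedMetric

open Set Filter Topology

variable {X Y : Type*}

theorem rdist_comm (D : ExtendedMetric X) (x y : X) : D.rdist x y = D.rdist y x := by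
  rw [rdist, rdist, D.symm]

theorem rdist_nonneg (D : ExtendedMetric X) (x y : X) : 0 ≤ D.rdist x y := by
  unfold rdist
  split_ifs
  · exact zero_le_one
  · exact ENNReal.toReal_nonneg

theorem rdist_self (D : ExtendedMetric X) (x : X) : D.rdist x x = 0 :=
  (D.rdist_eq_zero_iff x x).2 rfl

theorem rdist_of_notMem (D : ExtendedMetric X) {x y : X} (hx : x ∉ D.Ω) (hy : y ∉ D.Ω) :
    D.rdist x y = (D.d x y).toReal := by
  rw [rdist, if_neg (D.ne_top x y hx hy)]

theorem rdist_of_mem (D : ExtendedMetric X) {x y : X} (hx : x ∉ D.Ω) (hy : y ∈ D.Ω) :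
    D.rdist x y = 1 := by
  rw [rdist, if_pos (D.remote x y hx hy)]

theorem IsPtolemy.rdist_le {D : ExtendedMetric X} (hD : D.IsPtolemy) (x y z w : X) :
    D.rdist x y * D.rdist z w ≤ D.rdist x z * D.rdist y w + D.rdist x w * D.rdist y z := by
  simpa [triple] using hD x y z w

open Classical in
/-- The conformal factor that turns an extended Ptolemy metric into a bounded metric. -/
noncomputable def weight (D : ExtendedMetric X) (p x : X) : ℝ :=
  (if x ∈ D.Ω then 0 else 1) + D.rdist x p

theorem one_le_weight (D : ExtendedMetric X) {p : X} (hp : p ∉ D.Ω) (x : X) : 1 ≤ D.weight p x := by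
  rw [weight]
  split_ifs with h
  · rw [rdist_comm, D.rdist_of_mem hp h, zero_add]
  · linarith [D.rdist_nonneg x p]

-- The Ptolemy inequality with an ideal fourth point at infinity, the indicator serving as distance
-- from it; for finite points this is the triangle inequality.
open Classical in
theorem indicator_mul_rdist_le (D : ExtendedMetric X) (x y z : X) :
    (if z ∈ D.Ω then 0 else 1) * D.rdist x y ≤
      (if x ∈ D.Ω then 0 else 1) * D.rdist z y + (if y ∈ D.Ω then 0 else 1) * D.rdist x z := by
  have h1 := D.rdist_nonneg z y
  have h2 := D.rdist_nonneg x z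
  split_ifs with hz hx hy hy hx hy hy
  · simp
  · simpa using h2
  · simpa using h1
  · simpa using add_nonneg h1 h2
  · rw [D.Ω_subsingleton hx hy, rdist_self]; simp
  · rw [D.rdist_comm x y, D.rdist_of_mem hy hx, D.rdist_comm x z, D.rdist_of_mem hz hx]; simp
  · rw [D.rdist_of_mem hx hy, D.rdist_of_mem hz hy]; simp
  · rw [D.rdist_of_notMem hx hy, D.rdist_of_notMem hz hy, D.rdist_of_notMem hx hz, one_mul, one_mul,
      one_mul, add_comm, ← ENNReal.toReal_add (D.ne_top _ _ hx hz) (D.ne_top _ _ hz hy)]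
    exact ENNReal.toReal_mono
      (ENNReal.add_ne_top.2 ⟨D.ne_top _ _ hx hz, D.ne_top _ _ hz hy⟩) (D.triangle x z y hx hz hy)

/-- Ptolemy is linear in the distances from the fourth point, so the instances for infinity and for
`p` add up. The sum is the triangle inequality of the rescaled metric with denominators cleared. -/
theorem IsPtolemy.weight_mul_rdist_le {D : ExtendedMetric X} (hD : D.IsPtolemy) (p x y z : X) :
    D.weight p z * D.rdist x y ≤ D.weight p x * D.rdist z y + D.weight p y * D.rdist x z := by
  have h1 := D.indicator_mul_rdist_le x y z
  have h2 := hD.rdist_le x y z p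
  simp only [weight]
  rw [D.rdist_comm z y]
  rw [D.rdist_comm z y] at h1
  linarith

/-- A bounded metric that is Möbius equivalent to a given extended Ptolemy metric. -/
@[reducible] noncomputable def IsPtolemy.metricSpace {D : ExtendedMetric X} (hD : D.IsPtolemy) {p : X}
    (hp : p ∉ D.Ω) : MetricSpace X where
  dist x y := D.rdist x y / (D.weight p x * D.weight p y)
  dist_self x := by rw [rdist_self, zero_div]
  dist_comm x y := by rw [rdist_comm, mul_comm (D.weight p x)]
  dist_triangle x y z := by
    have hx := zero_lt_one.trans_le (D.one_le_weight hp x)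
    have hy := zero_lt_one.trans_le (D.one_le_weight hp y)
    have hz := zero_lt_one.trans_le (D.one_le_weight hp z)
    have := hD.weight_mul_rdist_le p x z y
    have e : D.rdist x y / (D.weight p x * D.weight p y) +
        D.rdist y z / (D.weight p y * D.weight p z) - D.rdist x z / (D.weight p x * D.weight p z) =
        (D.weight p x * D.rdist y z + D.weight p z * D.rdist x y - D.weight p y * D.rdist x z) /
          (D.weight p x * D.weight p y * D.weight p z) := by
      field_simp
      ring
    have h0 : 0 ≤ (D.weight p x * D.rdist y z + D.weight p z * D.rdist x y -
        D.weight p y * D.rdist x z) / (D.weight p x * D.weight p y * D.weight p z) :=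
      div_nonneg (by linarith) (by positivity)
    linarith
  eq_of_dist_eq_zero {x y} h := by
    have hx := zero_lt_one.trans_le (D.one_le_weight hp x)
    have hy := zero_lt_one.trans_le (D.one_le_weight hp y)
    exact (D.rdist_eq_zero_iff x y).1 ((div_eq_zero_iff.1 h).resolve_right (mul_pos hx hy).ne')

theorem IsPtolemy.ptolemySpace {D : ExtendedMetric X} (hD : D.IsPtolemy) {p : X}
    (hp : p ∉ D.Ω) : @PtolemySpace X (hD.metricSpace hp) := by
  intro x y z w
  have hx := zero_lt_one.trans_le (D.one_le_weight hp x)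
  have hy := zero_lt_one.trans_le (D.one_le_weight hp y)
  have hz := zero_lt_one.trans_le (D.one_le_weight hp z)
  have hw := zero_lt_one.trans_le (D.one_le_weight hp w)
  have := hD.rdist_le x y z w
  change D.rdist x y / (D.weight p x * D.weight p y) * (D.rdist z w /
    (D.weight p z * D.weight p w)) ≤ D.rdist x z / (D.weight p x * D.weight p z) *
    (D.rdist y w / (D.weight p y * D.weight p w)) + D.rdist x w / (D.weight p x * D.weight p w) *
    (D.rdist y z / (D.weight p y * D.weight p z))
  have e : D.rdist x z / (D.weight p x * D.weight p z) *
    (D.rdist y w / (D.weight p y * D.weight p w)) + D.rdist x w / (D.weight p x * D.weight p w) *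
    (D.rdist y z / (D.weight p y * D.weight p z)) -
    D.rdist x y / (D.weight p x * D.weight p y) * (D.rdist z w /
    (D.weight p z * D.weight p w)) =
    (D.rdist x z * D.rdist y w + D.rdist x w * D.rdist y z - D.rdist x y * D.rdist z w) /
      (D.weight p x * D.weight p y * D.weight p z * D.weight p w) := by
    field_simp
  have h0 : 0 ≤ (D.rdist x z * D.rdist y w + D.rdist x w * D.rdist y z -
    D.rdist x y * D.rdist z w) /
      (D.weight p x * D.weight p y * D.weight p z * D.weight p w) :=
    div_nonneg (by linarith) (by positivity)
  linarith

/-- This direction transports compactness, continuity of circle parametrizations and connectedness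
to the metric topology. -/
theorem IsPtolemy.topology_le {D : ExtendedMetric X} (hD : D.IsPtolemy) {p : X} (hp : p ∉ D.Ω) :
    D.topology ≤ (hD.metricSpace hp).toUniformSpace.toTopologicalSpace := by
  let _ := hD.metricSpace hp
  have hdist : ∀ x y : X, dist x y = D.rdist x y / (D.weight p x * D.weight p y) := fun _ _ => rfl
  intro U hU
  rw [Metric.isOpen_iff] at hU
  rw [@isOpen_iff_forall_mem_open X D.topology]
  intro x hx
  obtain ⟨ε, hε, hball⟩ := hU x hx
  have hwx := D.one_le_weight hp x
  by_cases hxΩ : x ∈ D.Ω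
  · obtain ⟨R, hR⟩ : ∃ R : ℝ≥0, (R : ℝ) = 1 / ε := ⟨⟨1 / ε, by positivity⟩, rfl⟩
    refine ⟨{y | D.d p y ≤ R}ᶜ, fun y hy => ?_,
      TopologicalSpace.GenerateOpen.basic _ (Or.inr ⟨p, hp, R, ?_, rfl⟩), ?_⟩
    · by_cases hyΩ : y ∈ D.Ω
      · rwa [D.Ω_subsingleton hyΩ hxΩ]
      · refine hball ?_
        rw [Metric.mem_ball, hdist, D.rdist_of_mem hyΩ hxΩ]
        have h1 : 1 / ε < D.rdist y p := by
          rw [rdist_comm, D.rdist_of_notMem hp hyΩ]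
          have := (ENNReal.toReal_lt_toReal ENNReal.coe_ne_top (D.ne_top p y hp hyΩ)).2 (not_le.1 hy)
          rwa [ENNReal.coe_toReal, hR] at this
        have h2 : 1 / ε < D.weight p y := by
          rw [weight, if_neg hyΩ]; linarith
        have h3 : 0 < 1 / ε := by positivity
        have h4 : D.weight p y * 1 ≤ D.weight p y * D.weight p x := by
          have := h3.trans h2
          gcongr
        rw [div_lt_iff₀ (by nlinarith)]
        rw [div_lt_iff₀ hε] at h2
        nlinarith
    · exact NNReal.coe_pos.1 (hR ▸ (by positivity : (0 : ℝ) < 1 / ε))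
    · change ¬ D.d p x ≤ _
      rw [D.remote p x hp hxΩ]
      simp
  · obtain ⟨R, hR⟩ : ∃ R : ℝ≥0, (R : ℝ) = ε := ⟨⟨ε, hε.le⟩, rfl⟩
    have hR0 : 0 < R := NNReal.coe_pos.1 (hR ▸ hε)
    refine ⟨{y | D.d x y < R}, fun y hy => ?_,
      TopologicalSpace.GenerateOpen.basic _ (Or.inl ⟨x, hxΩ, R, hR0, rfl⟩), ?_⟩
    · replace hy : D.d x y < R := hy
      have hyΩ : y ∉ D.Ω := fun h => by
        rw [D.remote x y hxΩ h] at hy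
        exact not_top_lt hy
      refine hball ?_
      rw [Metric.mem_ball, dist_comm, hdist, D.rdist_of_notMem hxΩ hyΩ]
      have h1 := (ENNReal.toReal_lt_toReal (D.ne_top x y hxΩ hyΩ) ENNReal.coe_ne_top).2 hy
      rw [ENNReal.coe_toReal, hR] at h1
      have hwy := D.one_le_weight hp y
      refine (div_le_self ENNReal.toReal_nonneg ?_).trans_lt h1
      nlinarith
    · change D.d x x < _
      rw [(D.eq_zero_iff x x hxΩ hxΩ).2 rfl]
      exact ENNReal.coe_pos.2 hR0

theorem IsCircle.exists_param {D : ExtendedMetric X} {σ : Set X} (hσ : D.IsCircle σ) :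
    ∃ φ : Circle → X, @Continuous Circle X _ D.topology φ ∧ Function.Injective φ ∧
      range φ = σ := by
  let _ : TopologicalSpace X := D.topology
  obtain ⟨⟨h⟩, -⟩ := hσ
  refine ⟨fun u => (h.symm u).1, continuous_subtype_val.comp h.symm.continuous,
    Subtype.val_injective.comp h.symm.injective, ?_⟩
  rw [range_comp' Subtype.val h.symm, h.symm.surjective.range_eq, image_univ, Subtype.range_coe]

/-- Divided by the distances from `w`, the Ptolemy equality is additivity of `invDist w` along the
circle cut open at `w`. -/
theorem IsCircle.exists_line {D : ExtendedMetric X} (hD : D.IsPtolemy) {p : X} (hp : p ∉ D.Ω)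
    {σ : Set X} (hσ : D.IsCircle σ) {w x z : X} (hw : w ∈ σ) (hx : x ∈ σ) (hz : z ∈ σ)
    (hxw : x ≠ w) (hzw : z ≠ w) :
    let _ := hD.metricSpace hp
    ∃ c : ℝ → X, (∀ t, c t ≠ w) ∧ (∀ s t, invDist w (c s) (c t) = |s - t|) ∧ c 0 = x ∧
      c (invDist w x z) = z := by
  obtain ⟨φ, hφD, hφinj, hφrange⟩ := hσ.exists_param
  have hφmem : ∀ u, φ u ∈ σ := fun u => hφrange ▸ mem_range_self u
  have hφsurj : ∀ y ∈ σ, ∃ u, φ u = y := fun y hy => by rwa [← hφrange] at hy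
  have hptol := hσ.2
  intro m
  have hle := hD.topology_le hp
  have hφ : Continuous φ := continuous_le_rng hle hφD
  obtain ⟨u₀, hu₀⟩ := hφsurj w hw
  let γ : ℝ → X := fun t => φ (u₀ * Circle.exp t)
  have hγ : Continuous γ := hφ.comp (continuous_const.mul Circle.exp.continuous)
  have hper : Function.Periodic γ (2 * Real.pi) := fun t => by
    simp only [γ, Circle.periodic_exp t]
  have hγ0 : γ 0 = w := by simp only [γ, Circle.exp_zero, mul_one, hu₀]
  have hγT : γ (2 * Real.pi) = w := by rw [← hγ0, ← hper 0, zero_add]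
  have hpi := Real.two_pi_pos
  have hinj : ∀ s t, γ s = γ t → 0 ≤ s → s < 2 * Real.pi → 0 ≤ t → t < 2 * Real.pi → s = t := by
    intro s t hst hs hs' ht ht'
    obtain ⟨k, hk⟩ := Circle.exp_eq_exp.1 (mul_left_cancel (hφinj hst))
    have h1 : (k : ℝ) < 1 := by
      by_contra hcon
      push Not at hcon
      nlinarith
    have h2 : (-1 : ℝ) < k := by
      by_contra hcon
      push Not at hcon
      nlinarith
    have h3 : k = 0 := by
      have h1' : k < 1 := by exact_mod_cast h1
      have h2' : -1 < k := by exact_mod_cast h2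
      omega
    rw [hk, h3]; simp
  have hsurj : ∀ y ∈ σ, y ≠ w → ∃ t ∈ Ioo 0 (2 * Real.pi), γ t = y := by
    intro y hy hyw
    obtain ⟨u, hu⟩ := hφsurj y hy
    obtain ⟨t, ht, hteq⟩ := hper.exists_mem_Ico₀ hpi (Complex.arg (u₀⁻¹ * u : Circle))
    have he : γ t = y := by
      rw [← hteq, ← hu]
      simp only [γ, Circle.exp_arg, mul_inv_cancel_left]
    refine ⟨t, ⟨lt_of_le_of_ne ht.1 ?_, ht.2⟩, he⟩
    rintro rfl
    exact hyw (he.symm.trans hγ0)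
  have hne : ∀ t ∈ Ioo 0 (2 * Real.pi), γ t ≠ w := by
    intro t ht htw
    have := hinj t 0 (htw.trans hγ0.symm) ht.1.le ht.2 le_rfl hpi
    exact ht.1.ne' this
  obtain ⟨a, ha, rfl⟩ := hsurj x hx hxw
  obtain ⟨b, hb, rfl⟩ := hsurj z hz hzw
  refine exists_line_of_additive hpi hγ hγ0 hγT hne ?_ ha hb
  intro s t u hs hst htu hu
  have ms : s ∈ Ioo 0 (2 * Real.pi) := ⟨hs, hst.trans (htu.trans hu)⟩
  have mt : t ∈ Ioo 0 (2 * Real.pi) := ⟨hs.trans hst, htu.trans hu⟩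
  have mu : u ∈ Ioo 0 (2 * Real.pi) := ⟨hs.trans (hst.trans htu), hu⟩
  have hsep : ∀ t₁ t₂, t₁ ∈ Ioo 0 (2 * Real.pi) → t₂ ∈ Ioo 0 (2 * Real.pi) → t₁ ≠ t₂ →
      γ t₁ ≠ γ t₂ := fun t₁ t₂ h₁ h₂ hne h =>
    hne (hinj _ _ h h₁.1.le h₁.2 h₂.1.le h₂.2)
  -- Two complementary closed arcs cover `σ` and meet only in `γ s` and `γ u`; a connected set
  -- containing `γ t` and `w` would have to meet their intersection.
  have hcomp : w ∉ @connectedComponentIn X D.topology (σ \ {γ s, γ u}) (γ t) := by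
    intro hwC
    have hmem : γ t ∈ σ \ {γ s, γ u} := by
      refine ⟨hφmem _, ?_⟩
      rintro (h | h)
      · exact hsep t s mt ms hst.ne' h
      · exact hsep t u mt mu htu.ne h
    have hpre : IsPreconnected (@connectedComponentIn X D.topology (σ \ {γ s, γ u}) (γ t)) := by
      have h1 := @isPreconnected_connectedComponentIn X D.topology (γ t) (σ \ {γ s, γ u})
      have h2 := @IsPreconnected.image X X D.topology _ _ h1 id
        (@Continuous.continuousOn _ _ D.topology _ _ _ (continuous_id_iff_le.2 hle))
      rwa [image_id] at h2
    have hsub := @connectedComponentIn_subset X D.topology (σ \ {γ s, γ u}) (γ t)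
    have hself := @mem_connectedComponentIn X D.topology _ _ hmem
    have hA : IsClosed (γ '' Icc s u) := (isCompact_Icc.image hγ).isClosed
    have hB : IsClosed (γ '' Icc 0 s ∪ γ '' Icc u (2 * Real.pi)) :=
      (isCompact_Icc.image hγ).isClosed.union (isCompact_Icc.image hγ).isClosed
    have hcover : σ ⊆ γ '' Icc s u ∪ (γ '' Icc 0 s ∪ γ '' Icc u (2 * Real.pi)) := by
      intro y hy
      by_cases hyw : y = w
      · exact Or.inr (Or.inl ⟨0, ⟨le_rfl, hs.le⟩, hγ0.trans hyw.symm⟩)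
      · obtain ⟨r, hr, rfl⟩ := hsurj y hy hyw
        rcases le_total r s with h1 | h1
        · exact Or.inr (Or.inl ⟨r, ⟨hr.1.le, h1⟩, rfl⟩)
        rcases le_total r u with h2 | h2
        · exact Or.inl ⟨r, ⟨h1, h2⟩, rfl⟩
        · exact Or.inr (Or.inr ⟨r, ⟨h2, hr.2.le⟩, rfl⟩)
    obtain ⟨y, hyC, ⟨r, hr, hry⟩, hyB⟩ := isPreconnected_closed_iff.1 hpre _ _ hA hB
      (fun y hy => hcover (hsub hy).1) ⟨γ t, hself, ⟨t, ⟨hst.le, htu.le⟩, rfl⟩⟩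
      ⟨w, hwC, Or.inl ⟨0, ⟨le_rfl, hs.le⟩, hγ0⟩⟩
    have mr : r ∈ Ioo 0 (2 * Real.pi) := ⟨hs.trans_le hr.1, hr.2.trans_lt hu⟩
    refine (hsub hyC).2 ?_
    rcases hyB with ⟨r', hr', hry'⟩ | ⟨r', hr', hry'⟩
    · left
      have hrr : r = r' := hinj r r' (hry.trans hry'.symm) mr.1.le mr.2 hr'.1 (hr'.2.trans_lt ms.2)
      have : r = s := le_antisymm (hrr.le.trans hr'.2) hr.1
      rw [← hry, this]
    · right
      rcases hr'.2.eq_or_lt with h2 | h2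
      · exact absurd (hry.trans (hry'.symm.trans (by rw [h2, hγT]))) (hne r mr)
      · have hrr : r = r' := hinj r r' (hry.trans hry'.symm) mr.1.le mr.2
          (mu.1.le.trans hr'.1) h2
        have : r = u := le_antisymm hr.2 (hr'.1.trans hrr.ge)
        rw [mem_singleton_iff, ← hry, this]
  have hnodup : [γ s, γ t, γ u, w].Nodup := by
    simp only [List.nodup_cons, List.mem_cons, List.not_mem_nil, or_false, not_or,
      not_false_eq_true, List.nodup_nil, and_true]
    exact ⟨⟨hsep s t ms mt hst.ne, hsep s u ms mu (hst.trans htu).ne, hne s ms⟩,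
      ⟨hsep t u mt mu htu.ne, hne t mt⟩, hne u mu⟩
  have hpt := hptol (γ s) (hφmem _) (γ t) (hφmem _) (γ u) (hφmem _) w hw hnodup hcomp
  refine InvBetween.invDist_eq (hne s ms) (hne t mt) (hne u mu) ?_
  have hdist : ∀ x y : X, dist x y = D.rdist x y / (D.weight p x * D.weight p y) := fun _ _ => rfl
  have w1 := zero_lt_one.trans_le (D.one_le_weight hp (γ s))
  have w2 := zero_lt_one.trans_le (D.one_le_weight hp (γ t))
  have w3 := zero_lt_one.trans_le (D.one_le_weight hp (γ u))
  have w4 := zero_lt_one.trans_le (D.one_le_weight hp w)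
  rw [InvBetween]
  simp only [hdist]
  replace hpt : D.rdist (γ s) (γ u) * D.rdist (γ t) w =
      D.rdist (γ s) (γ t) * D.rdist (γ u) w + D.rdist (γ s) w * D.rdist (γ t) (γ u) := hpt
  field_simp
  linarith

theorem IsPtolemy.hasInvLines {D : ExtendedMetric X} (hD : D.IsPtolemy) {p : X} (hp : p ∉ D.Ω)
    (hcircle : ∀ x y z : X, x ≠ y → x ≠ z → y ≠ z → ∃ σ : Set X, D.IsCircle σ ∧ {x, y, z} ⊆ σ) :
    @HasInvLines X (hD.metricSpace hp) := by
  intro w x z hxw hzw hxz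
  obtain ⟨σ, hσ, hsub⟩ := hcircle w x z hxw.symm hzw.symm hxz
  exact hσ.exists_line hD hp (hsub (by simp)) (hsub (by simp)) (hsub (by simp)) hxw hzw

end ExtendedMetric

/-! ### Chordal distance under stereographic projection. -/

section Stereographic

variable {E : Type*} [NormedAddCommGroup E] [InnerProductSpace ℝ E] {v : E}

theorem dist_stereoInvFun_pole (hv : ‖v‖ = 1) (a : (ℝ ∙ v)ᗮ) :
    dist (stereoInvFun hv a : E) v = 4 / √(‖a‖ ^ 2 + 4) := by
  have h0 : inner ℝ v (a : E) = 0 := Submodule.mem_orthogonal_singleton_iff_inner_right.mp a.2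
  have h1 : (0 : ℝ) < ‖a‖ ^ 2 + 4 := by positivity
  refine (sq_eq_sq₀ dist_nonneg (by positivity)).1 ?_
  rw [div_pow, Real.sq_sqrt h1.le, dist_eq_norm, norm_sub_sq_real, norm_eq_of_mem_sphere, hv,
    stereoInvFun_apply, inner_smul_left, inner_add_left, inner_smul_left, inner_smul_left,
    real_inner_comm, h0, real_inner_self_eq_norm_sq, hv]
  simp only [conj_trivial]
  field_simp
  ring

theorem dist_stereoInvFun (hv : ‖v‖ = 1) (a b : (ℝ ∙ v)ᗮ) :
    dist (stereoInvFun hv a) (stereoInvFun hv b) =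
      4 * dist a b / (√(‖a‖ ^ 2 + 4) * √(‖b‖ ^ 2 + 4)) := by
  have ha0 : inner ℝ v (a : E) = 0 := Submodule.mem_orthogonal_singleton_iff_inner_right.mp a.2
  have hb0 : inner ℝ v (b : E) = 0 := Submodule.mem_orthogonal_singleton_iff_inner_right.mp b.2
  have ha1 : (0 : ℝ) < ‖a‖ ^ 2 + 4 := by positivity
  have hb1 : (0 : ℝ) < ‖b‖ ^ 2 + 4 := by positivity
  refine (sq_eq_sq₀ dist_nonneg (by positivity)).1 ?_
  have hab : dist a b ^ 2 = ‖a‖ ^ 2 - 2 * inner ℝ (a : E) (b : E) + ‖b‖ ^ 2 := by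
    rw [dist_eq_norm, norm_sub_sq_real]; rfl
  rw [div_pow, mul_pow, mul_pow, Real.sq_sqrt ha1.le, Real.sq_sqrt hb1.le, hab, Subtype.dist_eq,
    dist_eq_norm, norm_sub_sq_real, norm_eq_of_mem_sphere, norm_eq_of_mem_sphere,
    stereoInvFun_apply, stereoInvFun_apply]
  simp only [inner_smul_left, inner_smul_right, inner_add_left, inner_add_right, conj_trivial,
    ha0, hb0, real_inner_comm v, real_inner_self_eq_norm_sq, hv]
  field_simp
  ring

end Stereographic

/-! ### Conformal maps and the equivalence with the sphere. -/

namespace ExtendedMetric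

variable {X Y : Type*}

/-- A conformal change of the distance is a Möbius map. -/
theorem isMoebius_of_rdist {D : ExtendedMetric X} {E : ExtendedMetric Y} {f : X → Y} {μ : X → ℝ}
    (hμ : ∀ x, μ x ≠ 0) (h : ∀ x y, E.rdist (f x) (f y) = μ x * μ y * D.rdist x y) :
    IsMoebius D E f where
  injective x y hxy := by
    have := h x y
    rw [(E.rdist_eq_zero_iff _ _).2 hxy, zero_eq_mul] at this
    exact (D.rdist_eq_zero_iff x y).1 (this.resolve_left (mul_ne_zero (hμ x) (hμ y)))
  crt_map x y z w hA := by
    refine (Projectivization.mk_eq_mk_iff' ℝ _ _ _ _).2 ⟨μ x * μ y * μ z * μ w, ?_⟩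
    ext i
    fin_cases i <;> simp [triple, h] <;> ring

theorem rdist_chordalSphere (n : ℕ) (a b : Metric.sphere (0 : EuclideanSpace ℝ (Fin (n + 1))) 1) :
    (chordalSphere n).rdist a b = dist a b := by
  rw [rdist, if_neg, dist_edist]
  · rfl
  · exact edist_ne_top a b

end ExtendedMetric

/-- A metric space that becomes Euclidean after inversion at a point is conformal to a sphere. -/
theorem exists_bijective_sphere {X : Type*} [MetricSpace X] {y : X} {n : ℕ}
    (e : {x : X // x ≠ y} ≃ EuclideanSpace ℝ (Fin n))
    (he : ∀ a b, dist (e a) (e b) = invDist y a.1 b.1) :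
    ∃ (f : X → Metric.sphere (0 : EuclideanSpace ℝ (Fin (n + 1))) 1) (μ : X → ℝ),
      Function.Bijective f ∧ (∀ x, 0 < μ x) ∧
        ∀ a b, dist (f a) (f b) = μ a * μ b * dist a b := by
  classical
  have : Fact (Module.finrank ℝ (EuclideanSpace ℝ (Fin (n + 1))) = n + 1) := ⟨by simp⟩
  let v : EuclideanSpace ℝ (Fin (n + 1)) := EuclideanSpace.single 0 1
  have hv : ‖v‖ = 1 := by simp [v]
  have hv0 : v ≠ 0 := by
    rintro h
    simp [h] at hv
  let U := (OrthonormalBasis.fromOrthogonalSpanSingleton (𝕜 := ℝ) n hv0).repr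
  let pole : Metric.sphere (0 : EuclideanSpace ℝ (Fin (n + 1))) 1 := ⟨v, by simp [hv]⟩
  let g : {x : X // x ≠ y} → (ℝ ∙ v)ᗮ := fun x => U.symm (e x)
  have hg : ∀ a b, dist (g a) (g b) = invDist y a.1 b.1 := fun a b => by
    rw [← he, U.symm.dist_map]
  let f : X → Metric.sphere (0 : EuclideanSpace ℝ (Fin (n + 1))) 1 := fun x =>
    if h : x ≠ y then stereoInvFun hv (g ⟨x, h⟩) else pole
  -- The stereographic factor times that of the inversion; the constant `4` in the chordal formulas
  -- is split evenly as `2 * 2`, which fixes the value at `y`.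
  let μ : X → ℝ := fun x =>
    if h : x ≠ y then 2 / (√(‖g ⟨x, h⟩‖ ^ 2 + 4) * dist x y) else 2
  have hμ : ∀ x, 0 < μ x := by
    intro x
    by_cases h : x ≠ y
    · have := dist_pos.2 h
      simp only [μ, dif_pos h]
      positivity
    · simp only [μ, dif_neg h]
      exact two_pos
  have hpole : ∀ a, dist (f a) (f y) = μ a * μ y * dist a y := by
    intro a
    by_cases h : a ≠ y
    · have := (dist_pos.2 h).ne'
      have hy : ¬ (y ≠ y) := fun h => h rfl
      simp only [f, μ, dif_pos h, dif_neg hy]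
      rw [Subtype.dist_eq]
      refine (dist_stereoInvFun_pole hv _).trans ?_
      field_simp
      norm_num
    · push Not at h
      rw [h, dist_self, dist_self, mul_zero]
  have hfμ : ∀ a b, dist (f a) (f b) = μ a * μ b * dist a b := by
    intro a b
    by_cases ha : a ≠ y
    · by_cases hb : b ≠ y
      · have h1 := (dist_pos.2 ha).ne'
        have h2 := (dist_pos.2 hb).ne'
        simp only [f, μ, dif_pos ha, dif_pos hb]
        rw [dist_stereoInvFun, hg, invDist]
        field_simp
        ring
      · push Not at hb
        rw [hb]
        exact hpole a
    · push Not at ha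
      rw [ha, dist_comm, hpole b, dist_comm, mul_comm (μ b)]
  refine ⟨f, μ, ⟨fun a b hab => ?_, fun s => ?_⟩, hμ, hfμ⟩
  · have := hfμ a b
    rw [hab, dist_self, zero_eq_mul] at this
    exact dist_eq_zero.1 (this.resolve_left (mul_pos (hμ a) (hμ b)).ne')
  · by_cases hs : (s : EuclideanSpace ℝ (Fin (n + 1))) = v
    · refine ⟨y, ?_⟩
      have hy : ¬ (y ≠ y) := fun h => h rfl
      simp only [f, dif_neg hy]
      exact Subtype.ext hs.symm
    · refine ⟨(e.symm (U (stereoToFun v s))).1, ?_⟩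
      simp only [f, g, dif_pos (e.symm (U (stereoToFun v s))).2, Subtype.coe_eta,
        Equiv.apply_symm_apply, LinearIsometryEquiv.symm_apply_apply]
      exact stereo_left_inv hv hs

theorem theorem1p2 {X : Type*} (D : ExtendedMetric X)
    (hcompact : @CompactSpace X D.topology)
    (hptolemy : D.IsPtolemy)
    (hthree : ∃ x y z : X, x ≠ y ∧ x ≠ z ∧ y ≠ z)
    (hcircle : ∀ x y z : X, x ≠ y → x ≠ z → y ≠ z → ∃ σ : Set X, D.IsCircle σ ∧ {x, y, z} ⊆ σ) :
    ∃ n : ℕ, 1 ≤ n ∧ D.MoebiusEquivalent (ExtendedMetric.chordalSphere n) := by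
  obtain ⟨p, hp⟩ : ∃ p, p ∉ D.Ω := by
    obtain ⟨x, y, -, hxy, -⟩ := hthree
    by_contra! h
    exact hxy (D.Ω_subsingleton (h x) (h y))
  let _ := hptolemy.metricSpace hp
  have hK : CompactSpace X := by
    refine ⟨?_⟩
    have h1 := @IsCompact.image X X D.topology _ _ _ hcompact.isCompact_univ
      (continuous_id_iff_le.2 (hptolemy.topology_le hp))
    rwa [Set.image_id] at h1
  obtain ⟨y, n, hn, e, he⟩ :=
    (hptolemy.ptolemySpace hp).exists_euclidean (hptolemy.hasInvLines hp hcircle) hthree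
  obtain ⟨f, μ, hf, hμ, hfμ⟩ := exists_bijective_sphere e he
  have hw : ∀ x, 0 < D.weight p x := fun x => zero_lt_one.trans_le (D.one_le_weight hp x)
  refine ⟨n, hn, f, hf, ExtendedMetric.isMoebius_of_rdist (μ := fun x => μ x / D.weight p x)
    (fun x => (div_pos (hμ x) (hw x)).ne') fun a b => ?_⟩
  have h1 := hw a
  have h2 := hw b
  rw [ExtendedMetric.rdist_chordalSphere, hfμ]
  change μ a * μ b * (D.rdist a b / (D.weight p a * D.weight p b)) = _
  field_simp
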